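/- Let $k$ be a field with at least $n$ elements, $n\ge 2$ (for instance the finite field $\mathbb F_q$ with $q\ge n$, or its algebraic closure), let $F/k$ be an algebraic function field in one variable, and let $\mathbf Q=(Q_1,\dots,Q_n)$ be an $n$-tuple of distinct rational places of $F/k$, with normalized discrete valuations $v_{Q_1},\dots,v_{Q_n}$. Put $I=\{1,\dots,n\}$ and $\mathbb N_0=\{0,1,2,\dots\}$. For $\alpha\in\mathbb Z^n$ let $D_\alpha(\mathbf Q)=\sum_{i=1}^n\alpha_iQ_i$, and for a divisor $D$ let $\ell(D)$ be the $k$-dimension of $\mathcal L(D)=\{z\in F\setminus\{0\}:(z)+D\ge 0\}\cup\{0\}$. Let $H(\mathbf Q)$ be the set of all $\alpha\in\mathbb N_0^n$ such that $D_\alpha(\mathbf Q)$ is the pole divisor of some nonzero $f\in F$, and let $\widehat H(\mathbf Q)\subseteq\mathbb Z^n$ be the set of all $(-v_{Q_1}(f),\dots,-v_{Q_n}(f))$, where $f$ runs over the nonzero elements of $F$ that are regular at all places outside $\{Q_1,\dots,Q_n\}$. The pure gap set $G_0(\mathbf Q)$ is the set of all $\alpha\in\mathbb N_0^n\setminus H(\mathbf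 Q)$ with $\ell(D_\alpha(\mathbf Q))=\ell(D_\alpha(\mathbf Q)-Q_j)$ for every $j\in I$. For $\alpha\in\mathbb Z^n$ and a nonempty proper subset $J\subsetneq I$ let $\nabla_J(\alpha)$ be the set of all $\beta\in\widehat H(\mathbf Q)$ with $\beta_j=\alpha_j$ for $j\in J$ and $\beta_i<\alpha_i$ for $i\in I\setminus J$. An element $\alpha\in\widehat H(\mathbf Q)$ is called relative maximal if $\nabla_{\{i\}}(\alpha)=\emptyset$ for every $i\in I$ and $\nabla_J(\alpha)\ne\emptyset$ for every $J\subsetneq I$ with $|J|\ge 2$. Let $\Lambda(\mathbf Q)$ be the set of relative maximal elements of $\widehat H(\mathbf Q)$ that lie in $\mathbb N_0^n$. For $\beta^1,\dots,\beta^n\in\mathbb Z^n$ let $\mathrm{glb}(\beta^1,\dots,\beta^n)\in\mathbb Z^n$ be the coordinatewise minimum. Then $$G_0(\mathbf Q)=\Big\{\mathrm{glb}(\beta^1,\dots,\beta^n):\ \beta^l\in\Lambda(\mathbf Q)\ \text{and}\ \beta^l_l<\min_{j\in I,\ j\ne l}\beta^j_l\ \text{ for every } l\in I\Big\}.$$ 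-/

import Mathlib

open scoped WithZero RatFunc

noncomputable section

namespace FnField

/-- A place of `F / k`, given by its normalized discrete valuation, written multiplicatively
(`v f = exp (-v_P(f))`, `v 0 = 0`): a surjective valuation `F → ℤᵐ⁰` trivial on `k`.
Distinct places have distinct normalized valuations. -/
@[ext]
structure Place (k F : Type*) [Field k] [Field F] [Algebra k F] where
  /-- The normalized valuation, in multiplicative notation. -/
  v : Valuation F ℤᵐ⁰
  surj : Function.Surjective v
  trivial_on_base : ∀ a : k, a ≠ 0 → v (algebraMap k F a) = 1

variable {k F : Type*} [Field k] [Field F] [Algebra k F]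

/-- The discrete valuation `v_P(f) ∈ ℤ` of `f ≠ 0`. It is only used for `f ≠ 0`. -/
def Place.ord (P : Place k F) (f : F) : ℤ := -WithZero.log (P.v f)

/-- `P` is rational: its residue field `O_P / P` is `k`, i.e. every element of the valuation ring
`O_P` is congruent to a constant modulo the maximal ideal. -/
def Place.IsRational (P : Place k F) : Prop :=
  ∀ f : F, P.v f ≤ 1 → ∃ a : k, P.v (f - algebraMap k F a) < 1

lemma Place.v_algebraMap_le_one (P : Place k F) (a : k) : P.v (algebraMap k F a) ≤ 1 := by
  by_cases h : a = 0
  · simp [h]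
  · exact (P.trivial_on_base a h).le

variable (k F) in
/-- The group of divisors: finitely supported integral combinations of places. -/
abbrev Divisor : Type _ := Place k F →₀ ℤ

/-- The Riemann-Roch space `𝓛(D)` (see also `mem_riemannRochSpace_iff`). -/
def riemannRochSpace (D : Divisor k F) : Submodule k F where
  carrier := {z | ∀ P : Place k F, P.v z ≤ WithZero.exp (D P)}
  zero_mem' := fun P => by simp
  add_mem' := fun {x y} hx hy P => (P.v.map_add x y).trans (max_le (hx P) (hy P))
  smul_mem' := fun c x hx P => by
    rw [Algebra.smul_def, map_mul]
    calc P.v (algebraMap k F c) * P.v x ≤ 1 * WithZero.exp (D P) :=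
          mul_le_mul' (P.v_algebraMap_le_one c) (hx P)
      _ = WithZero.exp (D P) := one_mul _

/-- `𝓛(D) = {z ≠ 0 : (z) + D ≥ 0} ∪ {0}`. -/
lemma mem_riemannRochSpace_iff (D : Divisor k F) (z : F) :
    z ∈ riemannRochSpace D ↔ z = 0 ∨ ∀ P : Place k F, 0 ≤ P.ord z + D P := by
  change (∀ P : Place k F, P.v z ≤ WithZero.exp (D P)) ↔ _
  by_cases hz : z = 0
  · simp [hz]
  · simp only [hz, false_or]
    refine forall_congr' fun P => ?_
    have h0 : P.v z ≠ 0 := (Valuation.ne_zero_iff _).2 hz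
    rw [← WithZero.log_le_iff_le_exp h0, Place.ord]
    constructor <;> intro h <;> linarith

/-- `ℓ(D) = dim_k 𝓛(D)`. -/
def ell (D : Divisor k F) : ℕ := Module.finrank k (riemannRochSpace D)

/-- `IsPoleDivisor f D` says that `(f)_∞ = D`, for `f ≠ 0`. -/
def IsPoleDivisor (f : F) (D : Divisor k F) : Prop :=
  ∀ P : Place k F, D P = max (-P.ord f) 0

variable {n : ℕ}

/-- `D_α(Q) = α₁ Q₁ + ⋯ + αₙ Qₙ`. -/
def tupleDivisor (Q : Fin n → Place k F) (α : Fin n → ℤ) : Divisor k F :=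
  ∑ i, Finsupp.single (Q i) (α i)

/-- The Weierstrass semigroup `H(Q)`, as a subset of `ℕ₀ⁿ ⊆ ℤⁿ`. -/
def weierstrassSemigroup (Q : Fin n → Place k F) : Set (Fin n → ℤ) :=
  {α | (∀ i, 0 ≤ α i) ∧ ∃ f : F, f ≠ 0 ∧ IsPoleDivisor f (tupleDivisor Q α)}

/-- The gaps `G(Q) = ℕ₀ⁿ \ H(Q)`. -/
def gaps (Q : Fin n → Place k F) : Set (Fin n → ℤ) :=
  {α | (∀ i, 0 ≤ α i) ∧ α ∉ weierstrassSemigroup Q}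

/-- The pure gaps `G₀(Q)`. -/
def pureGaps (Q : Fin n → Place k F) : Set (Fin n → ℤ) :=
  {α | α ∈ gaps Q ∧
    ∀ j, ell (tupleDivisor Q α) = ell (tupleDivisor Q α - Finsupp.single (Q j) 1)}

/-- The set `R_Q` of functions regular outside `{Q₁, …, Qₙ}`. -/
def regularOutside (Q : Fin n → Place k F) : Set F :=
  {f | ∀ P : Place k F, P ∉ Set.range Q → P.v f ≤ 1}

/-- The generalized Weierstrass semigroup `Ĥ(Q) ⊆ ℤⁿ`. -/
def genWeierstrassSemigroup (Q : Fin n → Place k F) : Set (Fin n → ℤ) :=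
  {α | ∃ f ∈ regularOutside Q, f ≠ 0 ∧ ∀ i, α i = -(Q i).ord f}

/-- `∇̄_J(α)`. -/
def nablaBar (J : Finset (Fin n)) (α : Fin n → ℤ) : Set (Fin n → ℤ) :=
  {β | (∀ j ∈ J, β j = α j) ∧ ∀ i ∉ J, β i < α i}

/-- `∇_J(α) = ∇̄_J(α) ∩ Ĥ(Q)`. -/
def nabla (Q : Fin n → Place k F) (J : Finset (Fin n)) (α : Fin n → ℤ) : Set (Fin n → ℤ) :=
  nablaBar J α ∩ genWeierstrassSemigroup Q

/-- `α ∈ Ĥ(Q)` is maximal: `∇(α) = ⋃ᵢ ∇_{i}(α)` is empty. -/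
def IsMaximalElt (Q : Fin n → Place k F) (α : Fin n → ℤ) : Prop :=
  α ∈ genWeierstrassSemigroup Q ∧ ⋃ i, nabla Q {i} α = ∅

/-- `α` is relative maximal: it is maximal and `∇_J(α) ≠ ∅` for every proper subset `J` of the
index set with at least two elements. -/
def IsRelativeMaximal (Q : Fin n → Place k F) (α : Fin n → ℤ) : Prop :=
  IsMaximalElt Q α ∧
    ∀ J : Finset (Fin n), J ⊂ Finset.univ → 2 ≤ J.card → (nabla Q J α).Nonempty

/-- `Λ(Q)`: the relative maximal elements of `Ĥ(Q)` with nonnegative coordinates. -/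
def relMax (Q : Fin n → Place k F) : Set (Fin n → ℤ) :=
  {α | IsRelativeMaximal Q α ∧ ∀ i, 0 ≤ α i}

/-- The greatest lower bound `glb(β¹, …, βˢ)`, the coordinatewise minimum (for `s ≥ 1`). -/
def glb {s : ℕ} (β : Fin s → Fin n → ℤ) : Fin n → ℤ := fun l => ⨅ j, β j l

lemma glb_isLeast {s : ℕ} (hs : 1 ≤ s) (β : Fin s → Fin n → ℤ) (l : Fin n) :
    IsLeast (Set.range fun j => β j l) (glb β l) := by
  have : Nonempty (Fin s) := ⟨⟨0, hs⟩⟩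
  have hfin : (Set.range fun j => β j l).Finite := Set.finite_range _
  exact ⟨(Set.range_nonempty _).csInf_mem hfin, fun x hx => csInf_le hfin.bddBelow hx⟩

end FnField

end

/-! For `α ≥ 0`, being a pure gap means that at every `Q l` no function regular outside `Q` with
pole orders bounded by `α` attains the order `α l` (`mem_pureGaps_iff`). If `β` is relative maximal,
agrees with `α` at `l` and is strictly larger elsewhere, such a function would give a point of
`∇_{l}(β) = ∅`. The strict inequalities on the tuple put its minimum in this position relative to
every member, which gives one inclusion.

Conversely, `exists_mem_relMax` builds `β` from a gap at `l`. Raise the coordinates other than `l`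
as long as the gap survives (`exists_maximal_isGapAt`), then add 1 to each of them. Maximality
yields for each `i ≠ l` a function `f i` of pole order exactly `β l` at `Q l`, exactly `β i` at `Q
i`, and less at the other `Q j`. Scale the `f i` to a common leading coefficient at `Q l`. A
combination `∑ j ∈ J, c j • f j` with all `c j ≠ 0` then attains `β` on `J`, and attains `β l` at `Q
l` iff `∑ c j ≠ 0`. Suitable coefficients make every required `∇_J(β)` nonempty; for `n ≥ 3` they
exist once `k` has an element besides 0 and 1.

The raising stops because some function has order exactly `α l` at `Q l` and is regular away from `Q
l` and `Q i` (`exists_v_eq_exp_regular`). This strong approximation comes from the finiteness of an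
adelic quotient (`finiteDimensional_quotient_regularOn`), which rests on `F` being finite over
`k(y)` for transcendental `y`. -/

open IntermediateField Polynomial
open scoped IntermediateField.algebraAdjoinAdjoin

namespace FnField

variable {k F : Type*} [Field k] [Field F] [Algebra k F]

/-! ### Transcendence degree and finiteness over simple subextensions -/

section Transcendental

lemma trdeg_eq_one [Algebra (RatFunc k) F] [IsScalarTower k (RatFunc k) F] [FunctionField k F] :
    Algebra.trdeg k F = 1 := by
  have h1 : Algebra.trdeg k (RatFunc k) = 1 := by
    have h := lift_trdeg_add_eq k k[X] (RatFunc k)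
    have : Algebra.IsAlgebraic k[X] (RatFunc k) :=
      IsLocalization.isAlgebraic _ (nonZeroDivisors k[X])
    simpa [Polynomial.trdeg_of_isDomain, trdeg_eq_zero] using h.symm
  have h := lift_trdeg_add_eq k (RatFunc k) F
  simpa [h1, trdeg_eq_zero] using h.symm

/-- A function field is finite over the subfield generated by any transcendental element. -/
lemma finiteDimensional_adjoin_of_transcendental [Algebra (RatFunc k) F]
    [IsScalarTower k (RatFunc k) F] [FunctionField k F] (s : F) (hs : Transcendental k s) :
    FiniteDimensional k⟮s⟯ F := by
  have hb : IsTranscendenceBasis k (fun _ : Unit => s) := by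
    refine AlgebraicIndependent.isTranscendenceBasis_of_lift_trdeg_le_of_finite
      (algebraicIndependent_unique_type_iff.2 hs) ?_
    simp [trdeg_eq_one]
  have : Algebra.IsAlgebraic k⟮s⟯ F := by
    have h := hb.isAlgebraic_field
    rwa [Set.range_const] at h
  have : Algebra.EssFiniteType k[X] (RatFunc k) :=
    Algebra.EssFiniteType.of_isLocalization _ (nonZeroDivisors k[X])
  have : Algebra.EssFiniteType k (RatFunc k) := Algebra.EssFiniteType.comp k k[X] (RatFunc k)
  have : Algebra.EssFiniteType k F := Algebra.EssFiniteType.comp k (RatFunc k) F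
  have : Algebra.EssFiniteType k⟮s⟯ F := Algebra.EssFiniteType.of_comp k k⟮s⟯ F
  exact Algebra.finite_of_essFiniteType_of_isAlgebraic

end Transcendental

/-! ### Quotients `O / s O` of `s`-stable subspaces -/

section SubmodulesModS

variable {s : F} {O : Submodule k F}

lemma aeval_eq_coeff_zero_add (s : F) (p : k[X]) :
    aeval s p = algebraMap k F (p.coeff 0) + s * aeval s p.divX := by
  conv_lhs => rw [← Polynomial.divX_mul_X_add p]
  simp only [map_add, map_mul, aeval_X, aeval_C]
  ring

lemma aeval_mul_mem (hO : ∀ f ∈ O, s * f ∈ O) (p : k[X]) {f : F} (hf : f ∈ O) :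
    aeval s p * f ∈ O := by
  induction p using Polynomial.induction_on' with
  | add p q hp hq => simpa [add_mul] using O.add_mem hp hq
  | monomial n a =>
    have h : ∀ m : ℕ, s ^ m * f ∈ O := fun m => by
      induction m with
      | zero => simpa using hf
      | succ m ih => simpa [pow_succ', mul_assoc] using hO _ ih
    simpa [aeval_monomial, mul_assoc, ← Algebra.smul_def] using O.smul_mem a (h n)

/-- Elements of an `s`-stable subspace `O` that are `k`-independent modulo `s O` are independent
over `k(s)`. -/
lemma linearIndependent_adjoin_of_mod (hs : s ≠ 0) (hO : ∀ f ∈ O, s * f ∈ O)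
    {ι : Type*} [Fintype ι] (o : ι → F) (ho : ∀ i, o i ∈ O)
    (hind : ∀ c : ι → k, ∀ g ∈ O, ∑ i, c i • o i = s * g → c = 0) :
    LinearIndependent k⟮s⟯ o := by
  have key : ∀ N : ℕ, ∀ p : ι → k[X], (∀ i, (p i).natDegree < N) →
      ∑ i, aeval s (p i) * o i = 0 → p = 0 := by
    intro N
    induction N with
    | zero =>
      intro p hp _
      ext1 i
      exact absurd (hp i) (Nat.not_lt_zero _)
    | succ N ih =>
      intro p hp h0
      -- Modulo `s O` only the constant coefficients survive, so they vanish by independence. The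
      -- relation can then be divided by `s`, which lowers the degrees.
      have hsum : ∑ i, (p i).coeff 0 • o i = s * (-∑ i, aeval s (p i).divX * o i) := by
        have : ∑ i, aeval s (p i) * o i =
            ∑ i, (p i).coeff 0 • o i + s * ∑ i, aeval s (p i).divX * o i := by
          rw [Finset.mul_sum, ← Finset.sum_add_distrib]
          refine Finset.sum_congr rfl fun i _ => ?_
          rw [aeval_eq_coeff_zero_add, Algebra.smul_def]
          ring
        rw [h0] at this
        linear_combination -this
      have hc := hind _ _ (O.neg_mem (O.sum_mem fun i _ => aeval_mul_mem hO _ (ho i))) hsum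
      have hd : (fun i => (p i).divX) = 0 := by
        -- Here all `p i` are constant, and the degree bound `< 0` of the induction hypothesis is
        -- out of reach.
        by_cases hN : N = 0
        · ext1 i
          have : (p i).natDegree = 0 := by have := hp i; omega
          exact Polynomial.divX_eq_zero_iff.2 (Polynomial.eq_C_of_natDegree_eq_zero this)
        refine ih _ (fun i => ?_) ?_
        · rw [Polynomial.natDegree_divX_eq_natDegree_tsub_one]
          have := hp i
          omega
        · have h1 : ∑ i, (p i).coeff 0 • o i = 0 :=
            Finset.sum_eq_zero fun i _ => by simp [congrFun hc i]
          rw [h1] at hsum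
          simpa [hs] using hsum.symm
      ext1 i
      rw [← Polynomial.divX_mul_X_add (p i), congrFun hd i, show (p i).coeff 0 = 0 from congrFun hc i]
      simp
  rw [← LinearIndependent.iff_fractionRing (Algebra.adjoin k {s}) k⟮s⟯, Fintype.linearIndependent_iff]
  intro g hg
  have hex : ∀ i, ∃ p : k[X], aeval s p = (g i : F) := fun i => by
    have h : ((g i : Algebra.adjoin k {s}) : F) ∈ (aeval s : k[X] →ₐ[k] F).range :=
      (Algebra.adjoin_singleton_eq_range_aeval k s).le (g i).2
    exact h
  choose p hp using hex
  have hp0 := key ((Finset.univ.sup fun i => (p i).natDegree) + 1) p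
    (fun i => Nat.lt_succ_of_le (Finset.le_sup (f := fun i => (p i).natDegree) (Finset.mem_univ i)))
    (by simpa [hp, Subalgebra.smul_def] using hg)
  intro i
  ext
  rw [← hp i, congrFun hp0 i]
  simp

/-- `O / s O` is finite-dimensional for every `s`-stable subspace `O`. -/
lemma exists_fg_sup_map_mul [FiniteDimensional k⟮s⟯ F] (hs : s ≠ 0)
    (hO : ∀ f ∈ O, s * f ∈ O) :
    ∃ W : Submodule k F, W.FG ∧ W ≤ O ∧ O ≤ W ⊔ O.map (LinearMap.mulLeft k s) := by
  set N := (O.map (LinearMap.mulLeft k s)).comap O.subtype with hN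
  have hrank : Module.rank k (O ⧸ N) ≤ Module.finrank k⟮s⟯ F := by
    refine rank_le fun t ht => ?_
    choose r hr using fun x : t => Submodule.mkQ_surjective N x.1
    have hli := linearIndependent_adjoin_of_mod (s := s) (O := O) hs hO (fun x : t => (r x : F))
      (fun x => (r x).2) (fun c g hg h => by
        rw [Fintype.linearIndependent_iff] at ht
        funext x
        refine ht c ?_ x
        have h1 : ∑ i, c i • r i ∈ N := by
          refine ⟨g, hg, ?_⟩
          simp [← h]
        have h2 : N.mkQ (∑ i, c i • r i) = 0 := (Submodule.Quotient.mk_eq_zero N).2 h1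
        simpa only [hr, map_sum, map_smul] using h2)
    simpa using hli.fintype_card_le_finrank
  have : Module.Finite k (O ⧸ N) :=
    Module.rank_lt_aleph0_iff.1 (hrank.trans_lt (Cardinal.natCast_lt_aleph0))
  obtain ⟨t, ht⟩ := this.fg_top
  choose r hr using Submodule.mkQ_surjective N
  refine ⟨Submodule.span k ((fun x => (r x : F)) '' (t : Set (O ⧸ N))), ?_, ?_, ?_⟩
  · exact Submodule.fg_span ((Finset.finite_toSet t).image _)
  · rw [Submodule.span_le]
    rintro _ ⟨x, _, rfl⟩
    exact (r x).2
  · intro f hf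
    have hmem : N.mkQ ⟨f, hf⟩ ∈ (Submodule.span k (r '' (t : Set (O ⧸ N)))).map N.mkQ := by
      rw [Submodule.map_span, ← Set.image_comp]
      have : (N.mkQ ∘ r) = id := funext hr
      rw [this, Set.image_id, ht]
      trivial
    obtain ⟨w, hw, hwf⟩ := hmem
    have hsub : (⟨f, hf⟩ : O) - w ∈ N := by
      rw [← Submodule.ker_mkQ N, LinearMap.mem_ker, map_sub, hwf, sub_self]
    rw [Submodule.mem_sup]
    refine ⟨w, ?_, f - w, ?_, by ring⟩
    · have := Submodule.mem_map_of_mem (f := O.subtype) hw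
      rwa [Submodule.map_span, ← Set.image_comp] at this
    · exact hsub

/-- Iterating `O = W + s O` gives `O = W + s W + ⋯ + s ^ (m - 1) W + s ^ m O`. -/
lemma exists_fg_sup_map_mul_pow [FiniteDimensional k⟮s⟯ F] (hs : s ≠ 0)
    (hO : ∀ f ∈ O, s * f ∈ O) (m : ℕ) :
    ∃ W : Submodule k F, W.FG ∧ W ≤ O ∧ ∀ f ∈ O, ∃ w ∈ W, ∃ g ∈ O, f = w + s ^ m * g := by
  obtain ⟨W, hW, hWO, hle⟩ := exists_fg_sup_map_mul hs hO
  induction m with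
  | zero => exact ⟨⊥, Submodule.fg_bot, bot_le, fun f hf => ⟨0, rfl, f, hf, by simp⟩⟩
  | succ m ih =>
    obtain ⟨V, hV, hVO, h⟩ := ih
    refine ⟨V ⊔ W.map (LinearMap.mulLeft k (s ^ m)), hV.sup (hW.map _), sup_le hVO ?_, ?_⟩
    · rintro _ ⟨w, hw, rfl⟩
      simpa using aeval_mul_mem hO (X ^ m) (hWO hw)
    · intro f hf
      obtain ⟨v, hv, g, hg, rfl⟩ := h f hf
      obtain ⟨w, hw, _, ⟨g', hg', rfl⟩, rfl⟩ := Submodule.mem_sup.1 (hle hg)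
      refine ⟨v + s ^ m * w, Submodule.add_mem_sup hv ⟨w, hw, rfl⟩, g', hg', ?_⟩
      simp only [LinearMap.mulLeft_apply]
      ring

end SubmodulesModS

/-! ### Valuation rings of `F / k` and existence of zeros -/

section ValuationSubrings

instance (P : Place k F) : P.v.IsTrivialOn k := ⟨P.trivial_on_base⟩

lemma _root_.ValuationSubring.isTrivialOn_valuation (V : ValuationSubring F)
    (hV : ∀ c : k, algebraMap k F c ∈ V) : V.valuation.IsTrivialOn k := by
  refine ⟨fun a ha => le_antisymm ((V.valuation_le_one_iff _).2 (hV a)) ?_⟩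
  rw [Valuation.one_le_val_iff _ (by simpa using ha), ← map_inv₀, V.valuation_le_one_iff]
  exact hV _

lemma _root_.ValuationSubring.aeval_mem (V : ValuationSubring F)
    (hV : ∀ c : k, algebraMap k F c ∈ V) {s : F} (hs : s ∈ V) (p : k[X]) : aeval s p ∈ V := by
  induction p using Polynomial.induction_on' with
  | add p q hp hq => simpa using V.add_mem _ _ hp hq
  | monomial n a =>
    rw [aeval_monomial]
    exact V.mul_mem _ _ (hV a) (pow_mem hs n)

/-- Every element has a multiple by a nonzero polynomial in `s` which is integral over `k[s]`. -/
lemma exists_aeval_mul_mem {s : F} [FiniteDimensional k⟮s⟯ F] (f : F) :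
    ∃ p : k[X], aeval s p ≠ 0 ∧ ∀ V : ValuationSubring F, (∀ c : k, algebraMap k F c ∈ V) →
      s ∈ V → aeval s p * f ∈ V := by
  have : Algebra.IsAlgebraic (Algebra.adjoin k {s}) F :=
    Algebra.IsAlgebraic.trans (Algebra.adjoin k {s}) k⟮s⟯ F
  obtain ⟨⟨q, hq⟩, hq0, hint⟩ :=
    (Algebra.IsAlgebraic.isAlgebraic (R := Algebra.adjoin k {s}) f).exists_integral_multiple
  obtain ⟨p, rfl⟩ := (Algebra.adjoin_singleton_eq_range_aeval k s).le hq
  refine ⟨p, fun h => hq0 (Subtype.ext h), fun V hV hs => ?_⟩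
  have hle : (Algebra.adjoin k {s}).toSubring ≤ V.toSubring := by
    intro x hx
    obtain ⟨p, rfl⟩ := (Algebra.adjoin_singleton_eq_range_aeval k s).le hx
    exact V.aeval_mem hV hs p
  let _ : Algebra (Algebra.adjoin k {s}) V := (Subring.inclusion hle).toAlgebra
  have : IsScalarTower (Algebra.adjoin k {s}) V F := IsScalarTower.of_algebraMap_eq fun x => rfl
  have hVint : IsIntegral V (aeval s p * f) := hint.tower_top
  obtain ⟨z, hz⟩ := IsIntegrallyClosed.isIntegral_iff.1 hVint
  rw [← hz]
  exact z.2

/-- An element of `F` becomes integral at all zeros of `s` after multiplication by a power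
of `s`. -/
lemma exists_pow_mul_mem {s : F} [FiniteDimensional k⟮s⟯ F] (f : F) :
    ∃ m : ℕ, ∀ V : ValuationSubring F, (∀ c : k, algebraMap k F c ∈ V) →
      s ∈ V.nonunits → s ^ m * f ∈ V := by
  obtain ⟨p, hp0, hp⟩ := exists_aeval_mul_mem (k := k) (s := s) f
  have hp0' : p ≠ 0 := by
    rintro rfl
    simp at hp0
  -- Splitting off the power of `X` leaves `q` with `q(0) ≠ 0`, so `q(s)` is a unit at every zero of
  -- `s` and the power of `s` alone suffices.
  obtain ⟨q, hpq, hq⟩ := Polynomial.exists_eq_pow_rootMultiplicity_mul_and_not_dvd p hp0' 0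
  rw [C_0, sub_zero] at hpq hq
  refine ⟨p.rootMultiplicity 0, fun V hV hs => ?_⟩
  have hsV : s ∈ V := V.nonunits_le hs
  have htriv := V.isTrivialOn_valuation hV
  have hq1 : V.valuation (aeval s q) = 1 := by
    rw [aeval_eq_coeff_zero_add]
    have h1 : V.valuation (algebraMap k F (q.coeff 0)) = 1 :=
      htriv.eq_one _ (by rwa [Polynomial.X_dvd_iff] at hq)
    rw [Valuation.map_add_eq_of_lt_left _ ?_, h1]
    rw [h1, map_mul]
    exact mul_lt_one_of_lt_of_le (V.mem_nonunits_iff.1 hs)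
      ((V.valuation_le_one_iff _).2 (V.aeval_mem hV hsV _))
  have h := hp V hV hsV
  rw [hpq, ← V.valuation_le_one_iff] at h
  rw [← V.valuation_le_one_iff]
  simpa [hq1] using h

lemma Place.algebraMap_mem_valuationSubring (P : Place k F) (c : k) :
    algebraMap k F c ∈ P.v.valuationSubring :=
  P.v_algebraMap_le_one c

lemma Place.mem_nonunits_iff (P : Place k F) {s : F} :
    s ∈ P.v.valuationSubring.nonunits ↔ P.v s < 1 := by
  rw [ValuationSubring.mem_nonunits_iff]
  exact (P.v.isEquiv_valuation_valuationSubring.lt_one_iff_lt_one).symm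

/-- A valuation ring of `F / k` with `s` in its maximal ideal is noetherian. -/
lemma isNoetherianRing_of_mem_nonunits {s : F} [FiniteDimensional k⟮s⟯ F] (hs : s ≠ 0)
    (V : ValuationSubring F) (hV : ∀ c : k, algebraMap k F c ∈ V) (hsV : s ∈ V.nonunits) :
    IsNoetherianRing V := by
  rw [isNoetherianRing_iff_ideal_fg]
  intro I
  by_cases hI : I = ⊥
  · rw [hI]
    exact Submodule.fg_bot
  obtain ⟨f, hfI, hf0⟩ := Submodule.exists_mem_ne_zero_of_ne_bot hI
  -- Since `s ^ m * f⁻¹ ∈ V`, the ideal contains `s ^ m`. As `V / s ^ m V` is finite-dimensional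
  -- over `k`, finitely many further generators suffice.
  obtain ⟨m, hm⟩ := exists_pow_mul_mem (k := k) (s := s) (f : F)⁻¹
  have hf0' : (f : F) ≠ 0 := fun h => hf0 (Subtype.ext h)
  have hsV' : s ∈ V := V.nonunits_le hsV
  have hsI : (⟨s, hsV'⟩ : V) ^ m ∈ I := by
    have : (⟨s, hsV'⟩ : V) ^ m = ⟨_, hm V hV hsV⟩ * f := by
      ext
      simp [hf0']
    rw [this]
    exact I.mul_mem_left _ hfI
  let O : Submodule k F :=
    { carrier := V
      add_mem' := fun {a b} => V.add_mem a b
      zero_mem' := V.zero_mem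
      smul_mem' := fun c x hx => by
        rw [Algebra.smul_def]
        exact V.mul_mem _ _ (hV c) hx }
  obtain ⟨W, hWfg, hWO, hW⟩ := exists_fg_sup_map_mul_pow (k := k) (O := O) hs
    (fun f hf => V.mul_mem _ _ hsV' hf) m
  let I' : Submodule k F :=
    { carrier := {x | ∃ h : x ∈ V, (⟨x, h⟩ : V) ∈ I}
      add_mem' := fun {a b} ⟨ha, ha'⟩ ⟨hb, hb'⟩ => ⟨V.add_mem _ _ ha hb, I.add_mem ha' hb'⟩
      zero_mem' := ⟨V.zero_mem, I.zero_mem⟩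
      smul_mem' := fun c x ⟨hx, hx'⟩ => by
        rw [Algebra.smul_def]
        exact ⟨V.mul_mem _ _ (hV c) hx, I.mul_mem_left ⟨_, hV c⟩ hx'⟩ }
  have : FiniteDimensional k W := Module.Finite.of_fg hWfg
  have hfin : FiniteDimensional k (W ⊓ I' : Submodule k F) :=
    Submodule.finiteDimensional_inf_left W I'
  obtain ⟨t, ht⟩ := (Submodule.fg_iff_finiteDimensional _).2 hfin
  have htI : ∀ x ∈ t, x ∈ I' := fun x hx =>
    (ht.le (Submodule.subset_span hx) : x ∈ W ⊓ I').2
  let g : t → V := fun x => ⟨x.1, (htI x.1 x.2).1⟩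
  have hJ : I = Ideal.span (insert ((⟨s, hsV'⟩ : V) ^ m) (Set.range g)) := by
    apply le_antisymm
    · intro x hx
      obtain ⟨w, hw, y, hy, hxy⟩ := hW x x.2
      have hx' : (x : F) ∈ I' := ⟨x.2, hx⟩
      have hsy : s ^ m * y ∈ I' :=
        ⟨V.mul_mem _ _ (pow_mem hsV' m) hy, I.mul_mem_right ⟨y, hy⟩ hsI⟩
      have hwI : w ∈ I' := by
        have := I'.sub_mem hx' hsy
        rwa [hxy, add_sub_cancel_right] at this
      have hwspan : ∀ z ∈ Submodule.span k (t : Set F), ∃ h : z ∈ V,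
          (⟨z, h⟩ : V) ∈ Ideal.span (insert ((⟨s, hsV'⟩ : V) ^ m) (Set.range g)) := by
        intro z hz
        induction hz using Submodule.span_induction with
        | mem z hz => exact ⟨(htI z hz).1, Ideal.subset_span (Or.inr ⟨⟨z, hz⟩, rfl⟩)⟩
        | zero => exact ⟨V.zero_mem, Ideal.zero_mem _⟩
        | add a b _ _ ha hb =>
          exact ⟨V.add_mem _ _ ha.1 hb.1, Ideal.add_mem _ ha.2 hb.2⟩
        | smul c a _ ha =>
          rw [Algebra.smul_def]
          exact ⟨V.mul_mem _ _ (hV c) ha.1, Ideal.mul_mem_left _ ⟨_, hV c⟩ ha.2⟩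
      obtain ⟨hwV, hwJ⟩ := hwspan w (ht.ge ⟨hw, hwI⟩)
      have hx : x = ⟨w, hwV⟩ + (⟨s, hsV'⟩ : V) ^ m * ⟨y, hy⟩ := Subtype.ext hxy
      rw [hx]
      exact Ideal.add_mem _ hwJ (Ideal.mul_mem_right _ _ (Ideal.subset_span (Or.inl rfl)))
    · rw [Ideal.span_le]
      rintro _ (rfl | ⟨x, rfl⟩)
      · exact hsI
      · exact (htI x.1 x.2).2
  rw [hJ]
  exact Submodule.fg_span ((Set.finite_range g).insert _)

/-- Every transcendental element of `F` has a zero. -/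
lemma exists_place_lt_one {s : F} (hs : Transcendental k s) [FiniteDimensional k⟮s⟯ F] :
    ∃ P : Place k F, P.v s < 1 := by
  have hs0 : s ≠ 0 := by
    rintro rfl
    exact hs isAlgebraic_zero
  let A : Subring F := (Algebra.adjoin k {s}).toSubring
  have hsA : s ∈ A := Algebra.self_mem_adjoin_singleton k s
  have hI : Ideal.span {(⟨s, hsA⟩ : A)} ≠ ⊤ := by
    rw [Ne, Ideal.span_singleton_eq_top]
    intro hu
    obtain ⟨⟨x, hx⟩, hx1⟩ := isUnit_iff_exists_inv.1 hu
    obtain ⟨p, rfl⟩ := (Algebra.adjoin_singleton_eq_range_aeval k s).le hx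
    have h1 : s * aeval s p = 1 := congrArg Subtype.val hx1
    refine hs ⟨X * p - 1, fun h => ?_, ?_⟩
    · have := congrArg (fun q : k[X] => q.coeff 0) h
      simp at this
    · simp [h1]
  -- The proper ideal `(s)` of `k[s]` lies under the maximal ideal of some valuation ring, which is
  -- then noetherian, hence discrete.
  obtain ⟨V, hAV, hIV⟩ := Ideal.image_subset_nonunits_valuationSubring _ hI
  have hV : ∀ c : k, algebraMap k F c ∈ V := fun c => hAV (Subalgebra.algebraMap_mem _ c)
  have hsV : s ∈ V.nonunits := hIV ⟨⟨s, hsA⟩, Ideal.subset_span rfl, rfl⟩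
  have hnoeth := isNoetherianRing_of_mem_nonunits hs0 V hV hsV
  obtain ⟨hsV', hsmax⟩ := V.mem_nonunits_iff_exists_mem_maximalIdeal.1 hsV
  have hfield : ¬ IsField V := by
    intro h
    rw [IsLocalRing.isField_iff_maximalIdeal_eq.1 h] at hsmax
    exact hs0 (congrArg Subtype.val hsmax)
  have hdvr : IsDiscreteValuationRing V := by
    have : IsPrincipalIdealRing V := IsBezout.TFAE.out 0 1 |>.1 hnoeth
    exact ⟨fun h => hfield (IsLocalRing.isField_iff_maximalIdeal_eq.2 h)⟩
  let M := IsDiscreteValuationRing.maximalIdeal V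
  have hle : ∀ x ∈ V, M.valuation F x ≤ 1 := fun x hx => M.valuation_le_one (K := F) (⟨x, hx⟩ : V)
  refine ⟨⟨M.valuation F, M.valuation_surjective F, fun a ha => ?_⟩, ?_⟩
  · refine le_antisymm (hle _ (hV a)) ?_
    rw [Valuation.one_le_val_iff _ (by simpa using ha), ← map_inv₀]
    exact hle _ (hV _)
  · exact (M.valuation_lt_one_iff_mem (K := F) (⟨s, hsV'⟩ : V)).2 hsmax

end ValuationSubrings

/-! ### Weak approximation for places -/

section Approximation

lemma Place.transcendental_of_one_lt (P : Place k F) {f : F} (h : 1 < P.v f) :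
    Transcendental k f :=
  Valuation.transcendental_of_ne_one k (v := P.v) f
    (fun h0 => by simp [h0] at h) h.ne'

lemma Place.v_smul (P : Place k F) {c : k} (hc : c ≠ 0) (f : F) : P.v (c • f) = P.v f := by
  rw [Algebra.smul_def, map_mul, P.trivial_on_base c hc, one_mul]

lemma Place.v_smul_le (P : Place k F) (c : k) (f : F) : P.v (c • f) ≤ P.v f := by
  rw [Algebra.smul_def, map_mul]
  exact mul_le_of_le_one_left' (P.v_algebraMap_le_one c)

lemma Place.exists_v_eq_exp (P : Place k F) (a : ℤ) : ∃ f : F, P.v f = WithZero.exp a :=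
  P.surj _

/-- Units at `P` are units at `P'`, so `P'.v` is a power of `P.v` determined by its value at a
uniformizer `π`. Surjectivity forces the exponent to be `±1`, and regularity of `π` at `P'` fixes
the sign. -/
lemma Place.eq_of_forall_le_one (P P' : Place k F) (h : ∀ z : F, P.v z ≤ 1 → P'.v z ≤ 1) :
    P = P' := by
  obtain ⟨π, hπ⟩ := P.exists_v_eq_exp (-1)
  have hπ0 : π ≠ 0 := by
    rintro rfl
    exact WithZero.exp_ne_zero (by rw [← hπ, map_zero])
  have hunit : ∀ z : F, P.v z = 1 → P'.v z = 1 := fun z hz => by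
    refine le_antisymm (h z hz.le) ?_
    have hz0 : z ≠ 0 := fun h0 => by simp [h0] at hz
    rw [Valuation.one_le_val_iff _ hz0]
    exact h _ (by simp [hz])
  have hpow : ∀ z : F, z ≠ 0 → P'.v z = P'.v π ^ (-WithZero.log (P.v z)) := fun z hz => by
    have hv : P.v z ≠ 0 := (Valuation.ne_zero_iff _).2 hz
    have h1 := hunit (z * π ^ WithZero.log (P.v z)) (by
      rw [map_mul, map_zpow₀, hπ, ← WithZero.exp_zsmul]
      conv_lhs => rw [← WithZero.exp_log hv]
      simp)
    rw [map_mul, map_zpow₀] at h1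
    rw [zpow_neg]
    exact eq_inv_of_mul_eq_one_left h1
  have hπ' : P'.v π ≠ 0 := (Valuation.ne_zero_iff _).2 hπ0
  obtain ⟨z, hz⟩ := P'.exists_v_eq_exp (-1)
  have hz0 : z ≠ 0 := by
    rintro rfl
    exact WithZero.exp_ne_zero (by rw [← hz, map_zero])
  have hle : WithZero.log (P'.v π) ≤ 0 := by
    have := h π (by rw [hπ, ← WithZero.exp_zero, WithZero.exp_le_exp]; norm_num)
    rwa [← WithZero.exp_zero, ← WithZero.log_le_iff_le_exp hπ'] at this
  have hlog := congrArg WithZero.log (hpow z hz0)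
  rw [hz, WithZero.log_exp, WithZero.log_zpow, smul_eq_mul] at hlog
  have hdvd : WithZero.log (P'.v π) ∣ 1 := ⟨WithZero.log (P.v z), by linarith⟩
  have hm1 : WithZero.log (P'.v π) = -1 := by
    rcases Int.isUnit_iff.1 (isUnit_of_dvd_one hdvd) with h | h <;> omega
  have hπ1 : P'.v π = WithZero.exp (-1) := by rw [← hm1, WithZero.exp_log hπ']
  ext z
  by_cases hz : z = 0
  · simp [hz]
  · rw [hpow z hz, hπ1, ← WithZero.exp_zsmul]
    have hv : P.v z ≠ 0 := (Valuation.ne_zero_iff _).2 hz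
    simp [WithZero.exp_log hv]

lemma Place.exists_lt_one_one_lt {P P' : Place k F} (h : P ≠ P') :
    ∃ z : F, P.v z < 1 ∧ 1 < P'.v z := by
  have h1 : ∃ z : F, P.v z ≤ 1 ∧ 1 < P'.v z := by
    by_contra! hc
    exact h (P.eq_of_forall_le_one P' hc)
  have h2 : ∃ z : F, P'.v z ≤ 1 ∧ 1 < P.v z := by
    by_contra! hc
    exact h (P'.eq_of_forall_le_one P hc).symm
  obtain ⟨z, hz, hz'⟩ := h1
  obtain ⟨w, hw, hw'⟩ := h2
  have hw0 : w ≠ 0 := fun h0 => by simp [h0] at hw'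
  refine ⟨z * w⁻¹, ?_, ?_⟩
  · rw [map_mul]
    refine mul_lt_one_of_nonneg_of_lt_one_right hz zero_le ?_
    rwa [← Valuation.one_lt_val_iff _ hw0]
  · rw [map_mul]
    refine lt_of_lt_of_le hz' (le_mul_of_one_le_right' ?_)
    rwa [← Valuation.val_le_one_iff _ hw0]

lemma eventually_lt_pow {x : ℤᵐ⁰} (hx : 1 < x) (y : ℤᵐ⁰) : ∀ᶠ m : ℕ in Filter.atTop, y < x ^ m := by
  obtain ⟨N, hN⟩ := MulArchimedean.arch y hx
  filter_upwards [Filter.eventually_gt_atTop N] with m hm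
  exact hN.trans_lt (pow_lt_pow_right₀ hx hm)

/-- Induction on `S`: if `z` works for `S` and `w` separates `P` from the new place, then `z + w ^
m` works for large `m`. Where `w` has no pole, `z` dominates; where it has one, `w ^ m` does. -/
lemma Place.exists_lt_one_forall_one_lt (P : Place k F) (S : Finset (Place k F)) (hS : P ∉ S) :
    ∃ z : F, P.v z < 1 ∧ ∀ P' ∈ S, 1 < P'.v z := by
  classical
  induction S using Finset.induction_on with
  | empty => exact ⟨0, by simp, by simp⟩
  | insert R S hR ih =>
    rw [Finset.mem_insert, not_or] at hS
    obtain ⟨z, hz, hzS⟩ := ih hS.2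
    obtain ⟨w, hw, hwR⟩ := Place.exists_lt_one_one_lt hS.1
    have key : ∀ P' : Place k F, 1 < P'.v w →
        ∀ᶠ m : ℕ in Filter.atTop, 1 < P'.v (z + w ^ m) := by
      intro P' h
      filter_upwards [eventually_lt_pow h (P'.v z), eventually_lt_pow h 1] with m h1 h2
      rw [← map_pow] at h1 h2
      rwa [Valuation.map_add_eq_of_lt_right _ h1]
    have hev : ∀ᶠ m : ℕ in Filter.atTop, ∀ P' ∈ S, 1 < P'.v (z + w ^ m) := by
      rw [Filter.eventually_all_finset]
      intro P' hP'
      rcases le_or_gt (P'.v w) 1 with h | h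
      · refine Filter.Eventually.of_forall fun m => ?_
        rw [Valuation.map_add_eq_of_lt_left]
        · exact hzS P' hP'
        · rw [map_pow]
          exact (pow_le_one₀ zero_le h).trans_lt (hzS P' hP')
      · exact key P' h
    obtain ⟨m, hm1, hm2, hm3⟩ :=
      ((key R hwR).and (hev.and (Filter.eventually_ge_atTop 1))).exists
    refine ⟨z + w ^ m, ?_, ?_⟩
    · refine Valuation.map_add_lt _ hz ?_
      rw [map_pow]
      exact pow_lt_one₀ zero_le hw (by omega)
    · intro P' hP'
      rcases Finset.mem_insert.1 hP' with rfl | h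
      · exact hm1
      · exact hm2 P' h

/-- There is an element congruent to `1` at `P` and to `0` at finitely many other places. -/
lemma Place.exists_sub_one_lt_one (P : Place k F) (S : Finset (Place k F)) (hS : P ∉ S) :
    ∃ e : F, P.v (e - 1) < 1 ∧ ∀ P' ∈ S, P'.v e < 1 := by
  obtain ⟨z, hz, hzS⟩ := P.exists_lt_one_forall_one_lt S hS
  have h1 : P.v (1 + z) = 1 := by
    rw [Valuation.map_add_eq_of_lt_left _ (by simpa using hz), map_one]
  have h0 : 1 + z ≠ 0 := fun h => by simp [h] at h1
  -- `(1 + z)⁻¹` is near 1 where `z` is small and near 0 where `z` is large.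
  refine ⟨(1 + z)⁻¹, ?_, fun P' hP' => ?_⟩
  · have : (1 + z)⁻¹ - 1 = -(z * (1 + z)⁻¹) := by
      field_simp
      ring
    rw [this, Valuation.map_neg, map_mul, map_inv₀, h1, inv_one, mul_one]
    exact hz
  · rw [← Valuation.one_lt_val_iff _ h0,
      Valuation.map_add_eq_of_lt_right _ (by simpa using hzS P' hP')]
    exact hzS P' hP'

lemma Place.v_eq_one_of_sub_one {P : Place k F} {e : F} (h : P.v (e - 1) < 1) : P.v e = 1 := by
  have := Valuation.map_add_eq_of_lt_right P.v (x := e - 1) (y := 1) (by simpa using h)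
  simpa using this

/-- There is an element of prescribed valuation at `P` which is regular at finitely many other
places. -/
lemma Place.exists_v_eq_exp_forall_le_one (P : Place k F) (S : Finset (Place k F)) (hS : P ∉ S)
    (a : ℤ) : ∃ u : F, P.v u = WithZero.exp a ∧ ∀ P' ∈ S, P'.v u ≤ 1 := by
  obtain ⟨e, he, heS⟩ := P.exists_sub_one_lt_one S hS
  obtain ⟨u, hu⟩ := P.exists_v_eq_exp a
  have he1 := Place.v_eq_one_of_sub_one he
  have he0 : e ≠ 0 := fun h => by simp [h] at he1
  have hev : ∀ᶠ m : ℕ in Filter.atTop, ∀ P' ∈ S, P'.v (u * e ^ m) ≤ 1 := by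
    rw [Filter.eventually_all_finset]
    intro P' hP'
    have h1 : 1 < P'.v e⁻¹ := by
      rw [Valuation.one_lt_val_iff _ (inv_ne_zero he0), inv_inv]
      exact heS P' hP'
    filter_upwards [eventually_lt_pow h1 (P'.v u)] with m hm
    have hpos : 0 < P'.v e ^ m := pow_pos (zero_lt_iff.2 ((Valuation.ne_zero_iff _).2 he0)) m
    rw [map_inv₀, inv_pow, ← mul_lt_mul_iff_left₀ hpos, inv_mul_cancel₀ hpos.ne'] at hm
    rw [map_mul, map_pow]
    exact hm.le
  obtain ⟨m, hm⟩ := hev.exists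
  exact ⟨u * e ^ m, by rw [map_mul, map_pow, he1, one_pow, mul_one, hu], hm⟩

end Approximation

/-! ### Finiteness of poles and of the adelic quotient -/

section Regular

/-- The elements of `F` that are regular at all places in `S`. -/
def regularOn (S : Set (Place k F)) : Submodule k F where
  carrier := {f | ∀ P ∈ S, P.v f ≤ 1}
  add_mem' := fun hx hy P hP => (P.v.map_add _ _).trans (max_le (hx P hP) (hy P hP))
  zero_mem' := fun P _ => by simp
  smul_mem' := fun c f hf P hP => (P.v_smul_le c f).trans (hf P hP)

lemma mul_mem_regularOn {S : Set (Place k F)} {f g : F} (hf : f ∈ regularOn S)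
    (hg : g ∈ regularOn S) : f * g ∈ regularOn S := fun P hP => by
  rw [map_mul]
  exact mul_le_one₀ (hf P hP) zero_le (hg P hP)

/-- A transcendental element has only finitely many poles. -/
lemma finite_poles {y : F} [FiniteDimensional k⟮y⁻¹⟯ F] (hy : y ≠ 0) :
    {P : Place k F | 1 < P.v y}.Finite := by
  classical
  by_contra hinf
  obtain ⟨T, hT, hcard⟩ :=
    Set.Infinite.exists_subset_card_eq hinf (Module.finrank k⟮y⁻¹⟯ F + 1)
  have hlt : ∀ P ∈ T, P.v y⁻¹ < 1 := fun P hP => by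
    rw [← Valuation.one_lt_val_iff _ hy]
    exact hT hP
  -- Modulo `y⁻¹` times the functions regular on `T`, the `e P` are independent: each is the only
  -- one that does not vanish at its own place. They stay independent over `k(y⁻¹)`, so there are at
  -- most `[F : k(y⁻¹)]` of them.
  choose e he he' using fun P : T =>
    P.1.exists_sub_one_lt_one (T.erase P.1) (Finset.notMem_erase _ _)
  have heO : ∀ P : T, e P ∈ regularOn (k := k) (T : Set (Place k F)) := fun P R hR => by
    by_cases h : R = P
    · subst h
      exact (Place.v_eq_one_of_sub_one (he P)).le
    · exact (he' P R (Finset.mem_erase.2 ⟨h, hR⟩)).le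
  have hli := linearIndependent_adjoin_of_mod (s := y⁻¹) (inv_ne_zero hy)
    (fun f hf => mul_mem_regularOn (fun P hP => (hlt P hP).le) hf) e heO (by
      intro c g hg h
      funext P
      by_contra hc
      have h1 : P.1.v (∑ i, c i • e i) < 1 := by
        rw [h, map_mul]
        exact mul_lt_one_of_lt_of_le (hlt P P.2) (hg P P.2)
      have h2 : P.1.v (∑ i, c i • e i) = 1 := by
        rw [← Finset.add_sum_erase _ _ (Finset.mem_univ P)]
        have h3 : P.1.v (c P • e P) = 1 := by
          rw [Place.v_smul _ hc, Place.v_eq_one_of_sub_one (he P)]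
        rw [Valuation.map_add_eq_of_lt_left, h3]
        rw [h3]
        refine Valuation.map_sum_lt _ one_ne_zero fun i hi => ?_
        refine (P.1.v_smul_le _ _).trans_lt (he' i P (Finset.mem_erase.2 ⟨?_, P.2⟩))
        intro h4
        exact (Finset.mem_erase.1 hi).1 (Subtype.ext h4.symm)
      exact h1.ne h2)
  have := hli.fintype_card_le_finrank
  rw [Fintype.card_coe, hcard] at this
  omega

/-- Euclidean division in `k(y)`: every element is a polynomial in `y` plus an element regular at
all poles of `y`. -/
lemma exists_aeval_add_mem_regularOn {y : F} {c : F} (hc : c ∈ k⟮y⟯) :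
    ∃ q : k[X], c - aeval y q ∈ regularOn {P : Place k F | 1 < P.v y} := by
  obtain ⟨a, d, rfl⟩ := (mem_adjoin_simple_iff k c).1 hc
  by_cases hd : aeval y d = 0
  · exact ⟨0, by simp [hd]⟩
  have hd' : d ≠ 0 := by
    rintro rfl
    simp at hd
  refine ⟨a / d, fun P (hP : 1 < P.v y) => ?_⟩
  have hmod : aeval y a / aeval y d - aeval y (a / d) = aeval y (a % d) / aeval y d := by
    have := congrArg (aeval y) (EuclideanDomain.div_add_mod a d)
    rw [map_add, map_mul] at this
    field_simp
    linear_combination -this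
  rw [hmod, map_div₀]
  by_cases hr : a % d = 0
  · simp [hr]
  rw [valuation_aeval_eq_valuation_X_pow_natDegree_of_one_lt_valuation_X y hP hr,
    valuation_aeval_eq_valuation_X_pow_natDegree_of_one_lt_valuation_X y hP hd']
  refine div_le_one_of_le₀ (pow_le_pow_right₀ hP.le ?_) zero_le
  exact Polynomial.natDegree_le_natDegree (EuclideanDomain.mod_lt a hd').le

/-- The first adelic cohomology group of the structure sheaf is finite-dimensional. -/
lemma finiteDimensional_quotient_regularOn {y : F} (hy : y ≠ 0) [FiniteDimensional k⟮y⟯ F]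
    [FiniteDimensional k⟮y⁻¹⟯ F] :
    FiniteDimensional k (F ⧸ (regularOn {P : Place k F | P.v y ≤ 1} ⊔
      regularOn {P : Place k F | 1 < P.v y})) := by
  set B := regularOn {P : Place k F | P.v y ≤ 1} with hB
  set O := regularOn {P : Place k F | 1 < P.v y} with hO
  have hs : ∀ P : Place k F, 1 < P.v y → P.v y⁻¹ < 1 := fun P hP => by
    rwa [← Valuation.one_lt_val_iff _ hy]
  have hsO : y⁻¹ ∈ O := fun P hP => (hs P hP).le
  -- Clearing denominators makes the basis elements `b i` lie in `B`, and `y⁻¹ ^ M` brings them into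
  -- `O`. Coefficients split as a polynomial in `y` plus an element of `O`, so `F = B + y ^ M O`,
  -- and `y ^ M O / O` is finite-dimensional like `O / y⁻¹ ^ M O`.
  let e := Module.finBasis k⟮y⟯ F
  choose p hp0 hp using fun i => exists_aeval_mul_mem (k := k) (s := y) (e i)
  set b := fun i => aeval y (p i) * e i with hb
  choose m hm using fun i => exists_pow_mul_mem (k := k) (s := y⁻¹) (b i)
  have hbB : ∀ i, b i ∈ B := fun i P hP =>
    hp i P.v.valuationSubring P.algebraMap_mem_valuationSubring hP
  have hbO : ∀ i, (y⁻¹) ^ (m i) * b i ∈ O := fun i P hP =>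
    hm i P.v.valuationSubring P.algebraMap_mem_valuationSubring (P.mem_nonunits_iff.2 (hs P hP))
  have hpowO : ∀ n : ℕ, (y⁻¹) ^ n ∈ O := fun n P hP => by
    rw [map_pow]
    exact pow_le_one₀ zero_le (hs P hP).le
  set M := Finset.univ.sup m
  have hbO' : ∀ i, (y⁻¹) ^ M * b i ∈ O := fun i => by
    have h : M = (M - m i) + m i := (Nat.sub_add_cancel (Finset.le_sup (Finset.mem_univ i))).symm
    rw [h, pow_add, mul_assoc]
    exact mul_mem_regularOn (hpowO _) (hbO i)
  obtain ⟨W, hWfg, hWO, hW⟩ := exists_fg_sup_map_mul_pow (k := k) (s := y⁻¹) (O := O)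
    (inv_ne_zero hy) (fun f hf => mul_mem_regularOn hsO hf) M
  have hdec : ∀ f : F, ∃ w ∈ W, ∃ n ∈ B ⊔ O, f = y ^ M * w + n := by
    intro f
    have hex : ∀ i, ∃ q : k[X], ((e.repr f i : k⟮y⟯) : F) / aeval y (p i) - aeval y q ∈ O := fun i =>
      exists_aeval_add_mem_regularOn (div_mem (e.repr f i).2
        (algebra_adjoin_le_adjoin k _ (aeval_mem_adjoin_singleton k y)))
    choose q hq using hex
    set o := fun i => ((e.repr f i : k⟮y⟯) : F) / aeval y (p i) - aeval y (q i) with ho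
    have hf : f = ∑ i, aeval y (q i) * b i + ∑ i, o i * b i := by
      conv_lhs => rw [← e.sum_repr f]
      rw [← Finset.sum_add_distrib]
      refine Finset.sum_congr rfl fun i _ => ?_
      rw [IntermediateField.smul_def, smul_eq_mul]
      have := hp0 i
      simp only [ho, hb]
      field_simp
      ring
    have hz : (y⁻¹) ^ M * ∑ i, o i * b i ∈ O := by
      rw [Finset.mul_sum]
      refine O.sum_mem fun i _ => ?_
      rw [mul_left_comm]
      exact mul_mem_regularOn (hq i) (hbO' i)
    obtain ⟨w, hw, g, hg, hwg⟩ := hW _ hz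
    refine ⟨w, hw, ∑ i, aeval y (q i) * b i + g, Submodule.add_mem_sup ?_ hg, ?_⟩
    · refine B.sum_mem fun i _ => ?_
      exact aeval_mul_mem (fun f hf => mul_mem_regularOn (fun P hP => hP) hf) _ (hbB i)
    · have hyM : y ^ M * (y⁻¹) ^ M = 1 := by rw [← mul_pow, mul_inv_cancel₀ hy, one_pow]
      have h := congrArg (fun t => y ^ M * t) hwg
      simp only [mul_add, ← mul_assoc, hyM, one_mul] at h
      rw [hf, h]
      ring
  have : FiniteDimensional k W := Module.Finite.of_fg hWfg
  refine Module.Finite.of_surjective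
    ((B ⊔ O).mkQ ∘ₗ LinearMap.mulLeft k (y ^ M) ∘ₗ W.subtype) fun x => ?_
  obtain ⟨f, rfl⟩ := Submodule.mkQ_surjective _ x
  obtain ⟨w, hw, n, hn, rfl⟩ := hdec f
  refine ⟨⟨w, hw⟩, ?_⟩
  simpa using hn

end Regular

/-! ### Strong approximation and finiteness of Riemann-Roch spaces -/

section Existence

lemma finiteDimensional_quotient_of_one_lt
    (hF : ∀ s : F, Transcendental k s → FiniteDimensional k⟮s⟯ F)
    {P : Place k F} {y : F} (h : 1 < P.v y) :
    FiniteDimensional k (F ⧸ (regularOn {P : Place k F | P.v y ≤ 1} ⊔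
      regularOn {P : Place k F | 1 < P.v y})) := by
  have hy : y ≠ 0 := fun h0 => by simp [h0] at h
  have ht := P.transcendental_of_one_lt h
  have := hF y ht
  have := hF y⁻¹ (by rwa [Transcendental, IsAlgebraic.inv_iff])
  exact finiteDimensional_quotient_regularOn hy

/-- For every place there is a function whose only pole is at that place. -/
lemma exists_unique_pole
    (hF : ∀ s : F, Transcendental k s → FiniteDimensional k⟮s⟯ F)
    (Q : Place k F) : ∃ x : F, 1 < Q.v x ∧ ∀ P, P ≠ Q → P.v x ≤ 1 := by
  classical
  obtain ⟨y, hy⟩ := Q.exists_v_eq_exp 1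
  have hy1 : 1 < Q.v y := by rw [hy, ← WithZero.exp_zero, WithZero.exp_lt_exp]; norm_num
  have hy0 : y ≠ 0 := fun h0 => by simp [h0] at hy1
  have hfd := finiteDimensional_quotient_of_one_lt hF hy1
  have := hF y⁻¹ (by
    rw [Transcendental, IsAlgebraic.inv_iff]
    exact Q.transcendental_of_one_lt hy1)
  have hfin := finite_poles (k := k) hy0
  set B := regularOn {P : Place k F | P.v y ≤ 1} with hB
  set O := regularOn {P : Place k F | 1 < P.v y} with hO
  -- The orders `j + 1` at `Q` are distinct, so a nontrivial combination of the `u j` keeps a pole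
  -- there. Infinitely many `u j` are dependent modulo `B ⊔ O`.
  choose u hu hu' using fun j : ℕ => Q.exists_v_eq_exp_forall_le_one (hfin.toFinset.erase Q)
    (Finset.notMem_erase _ _) (j + 1)
  have hdep : ¬ LinearIndependent k (fun j : ℕ => (B ⊔ O).mkQ (u j)) := fun h =>
    not_finite_iff_infinite.2 (inferInstanceAs (Infinite ℕ)) h.finite
  obtain ⟨g, hg, hg0⟩ : ∃ g : ℕ →₀ k, g.sum (fun j c => c • (B ⊔ O).mkQ (u j)) = 0 ∧ g ≠ 0 := by
    rw [linearIndependent_iff] at hdep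
    push Not at hdep
    simpa [Finsupp.linearCombination_apply] using hdep
  set z := ∑ j ∈ g.support, g j • u j with hz
  have hzmem : z ∈ B ⊔ O := by
    rw [← Submodule.Quotient.mk_eq_zero, ← Submodule.mkQ_apply, hz, map_sum, ← hg, Finsupp.sum]
    simp only [map_smul]
  have hne : g.support.Nonempty := Finsupp.support_nonempty_iff.2 hg0
  set n := g.support.max' hne with hn
  have hnmem : n ∈ g.support := Finset.max'_mem _ _
  have hzv : 1 < Q.v z := by
    have h1 : Q.v (g n • u n) = WithZero.exp ((n : ℤ) + 1) := by
      rw [Place.v_smul _ (Finsupp.mem_support_iff.1 hnmem), hu]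
    rw [hz, ← Finset.add_sum_erase _ _ hnmem, Valuation.map_add_eq_of_lt_left, h1,
      ← WithZero.exp_zero, WithZero.exp_lt_exp]
    · positivity
    · rw [h1]
      refine Valuation.map_sum_lt _ WithZero.exp_ne_zero fun j hj => ?_
      refine (Q.v_smul_le _ _).trans_lt ?_
      rw [hu, WithZero.exp_lt_exp]
      have := Finset.le_max' _ j (Finset.mem_of_mem_erase hj)
      have := Finset.ne_of_mem_erase hj
      omega
  -- The part `b` is regular wherever `y` is; at the poles of `y` it differs from `z` by the regular
  -- `o`.
  obtain ⟨b, hb, o, ho, hbo⟩ := Submodule.mem_sup.1 hzmem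
  have hb' : b = z - o := by rw [← hbo]; ring
  refine ⟨b, ?_, fun P hP => ?_⟩
  · rw [hb', Valuation.map_sub_eq_of_lt_left]
    · exact hzv
    · exact (ho Q hy1).trans_lt hzv
  · rcases le_or_gt (P.v y) 1 with h | h
    · exact hb P h
    · rw [hb']
      refine (Valuation.map_sub _ _ _).trans (max_le ?_ (ho P h))
      refine Valuation.map_sum_le _ fun j _ => (P.v_smul_le _ _).trans (hu' j P ?_)
      exact Finset.mem_erase.2 ⟨hP, hfin.mem_toFinset.2 h⟩

/-- A subspace of finite codimension which is stable under multiplication by a transcendental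
element is everything. -/
lemma eq_top_of_finiteDimensional_quotient {x : F} (hx : Transcendental k x) (N : Submodule k F)
    [FiniteDimensional k (F ⧸ N)] (hN : ∀ f ∈ N, x * f ∈ N) : N = ⊤ := by
  let T : Module.End k (F ⧸ N) := N.mapQ N (LinearMap.mulLeft k x) hN
  have hT : ∀ (p : k[X]) (f : F), aeval T p (N.mkQ f) = N.mkQ (aeval x p * f) := by
    intro p f
    induction p using Polynomial.induction_on' with
    | add p q hp hq => rw [map_add, LinearMap.add_apply, hp, hq, map_add, add_mul, map_add]
    | monomial n a =>
      have hpow : ∀ m : ℕ, (T ^ m) (N.mkQ f) = N.mkQ (x ^ m * f) := fun m => by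
        induction m with
        | zero => simp
        | succ m ih =>
          rw [pow_succ', Module.End.mul_apply, ih, pow_succ', mul_assoc]
          rfl
      rw [aeval_monomial, aeval_monomial, Module.End.mul_apply, hpow,
        Module.algebraMap_end_apply, ← map_smul, Algebra.smul_def, mul_assoc]
  -- From `p(T) = 0` follows `p(x) F ⊆ N`, while `p(x) F = F` because `p(x) ≠ 0`.
  obtain ⟨p, hp, hp0⟩ := Algebra.IsIntegral.isIntegral (R := k) T
  have hpx : aeval x p ≠ 0 := fun h => hx ⟨p, hp.ne_zero, h⟩
  rw [eq_top_iff]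
  intro f _
  have h := hT p ((aeval x p)⁻¹ * f)
  rw [mul_inv_cancel_left₀ hpx, show aeval T p = 0 from hp0] at h
  exact (Submodule.Quotient.mk_eq_zero N).1 h.symm

/-- Strong approximation at two places: there is a function with a pole of prescribed order at `P`
that is regular outside `P` and `Q`. -/
lemma exists_v_eq_exp_regular
    (hF : ∀ s : F, Transcendental k s → FiniteDimensional k⟮s⟯ F)
    {P Q : Place k F} (hPQ : P ≠ Q) (a : ℤ) (ha : 0 ≤ a) :
    ∃ f : F, P.v f = WithZero.exp a ∧ ∀ R, R ≠ P → R ≠ Q → R.v f ≤ 1 := by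
  rcases ha.eq_or_lt with rfl | ha
  · exact ⟨1, by simp, by simp⟩
  obtain ⟨xP, hxP, hxP'⟩ := exists_unique_pole hF P
  obtain ⟨xQ, hxQ, hxQ'⟩ := exists_unique_pole hF Q
  set y := xP + xQ with hy
  have hyP : 1 < P.v y := by
    rwa [hy, Valuation.map_add_eq_of_lt_left _ ((hxQ' P hPQ).trans_lt hxP)]
  have hyR : ∀ R, R ≠ P → R ≠ Q → R.v y ≤ 1 := fun R h1 h2 =>
    (R.v.map_add _ _).trans (max_le (hxP' R h1) (hxQ' R h2))
  have hfd := finiteDimensional_quotient_of_one_lt hF hyP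
  let B : Submodule k F := regularOn {R | R ≠ P ∧ R ≠ Q}
  let O : Submodule k F :=
    { carrier := {f | P.v f < WithZero.exp a}
      add_mem' := fun {f g} (h1 : P.v f < _) (h2 : P.v g < _) =>
        (P.v.map_add f g).trans_lt (max_lt h1 h2)
      zero_mem' := by simp
      smul_mem' := fun c f hf => (P.v_smul_le c f).trans_lt hf }
  have hle : regularOn {P : Place k F | P.v y ≤ 1} ⊔ regularOn {P : Place k F | 1 < P.v y} ≤
      B ⊔ O := by
    refine sup_le_sup (fun f hf R hR => hf R (hyR R hR.1 hR.2)) fun f hf => ?_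
    refine (hf P hyP).trans_lt ?_
    rwa [← WithZero.exp_zero, WithZero.exp_lt_exp]
  have : FiniteDimensional k (F ⧸ (B ⊔ O)) :=
    Module.Finite.of_surjective (Submodule.factor hle) (Submodule.factor_surjective hle)
  -- `xQ` is regular at `P` and has its only pole at `Q`, so it preserves both `O` and `B`.
  have htop := eq_top_of_finiteDimensional_quotient (Q.transcendental_of_one_lt hxQ) (B ⊔ O) (by
    intro f hf
    obtain ⟨b, hb, o, ho, rfl⟩ := Submodule.mem_sup.1 hf
    rw [mul_add]
    refine Submodule.add_mem_sup (mul_mem_regularOn (fun R hR => hxQ' R hR.2) hb) ?_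
    change P.v (xQ * o) < _
    rw [map_mul]
    exact (mul_le_of_le_one_left' (hxQ' P hPQ)).trans_lt ho)
  obtain ⟨u, hu⟩ := P.exists_v_eq_exp a
  obtain ⟨b, hb, o, ho, hbo⟩ := Submodule.mem_sup.1 (htop.ge (Submodule.mem_top (x := u)))
  refine ⟨b, ?_, fun R h1 h2 => hb R ⟨h1, h2⟩⟩
  have hb' : b = u - o := by rw [← hbo]; ring
  rw [hb', Valuation.map_sub_eq_of_lt_left, hu]
  rw [hu]
  exact ho

/-- If there is a rational place, functions without poles are constant. -/
lemma exists_algebraMap_eq_of_regular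
    (hF : ∀ s : F, Transcendental k s → FiniteDimensional k⟮s⟯ F)
    {Q : Place k F} (hQ : Q.IsRational) {z : F}
    (hz : ∀ P : Place k F, P.v z ≤ 1) : ∃ c : k, z = algebraMap k F c := by
  obtain ⟨c, hc⟩ := hQ z (hz Q)
  refine ⟨c, ?_⟩
  by_contra hne
  set t := z - algebraMap k F c with ht
  have ht0 : t ≠ 0 := sub_ne_zero.2 hne
  -- A zero of `t⁻¹` is a pole of `t`, hence of `z`, which has none.
  have htr : Transcendental k t⁻¹ := by
    refine Q.transcendental_of_one_lt ?_
    rwa [Valuation.one_lt_val_iff _ (inv_ne_zero ht0), inv_inv]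
  have := hF _ htr
  obtain ⟨P, hP⟩ := exists_place_lt_one htr
  have h1 : P.v t ≤ 1 := (Valuation.map_sub _ _ _).trans (max_le (hz P) (P.v_algebraMap_le_one c))
  rw [← Valuation.one_lt_val_iff _ ht0] at hP
  exact absurd h1 hP.not_ge

lemma finiteDimensional_riemannRochSpace_zero
    (hF : ∀ s : F, Transcendental k s → FiniteDimensional k⟮s⟯ F)
    {Q : Place k F} (hQ : Q.IsRational) :
    FiniteDimensional k (riemannRochSpace (0 : Divisor k F)) := by
  refine Module.Finite.of_surjective
    ((LinearMap.toSpanSingleton k F 1).codRestrict (riemannRochSpace (0 : Divisor k F))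
      fun c P => ?_) fun z => ?_
  · simp [Algebra.smul_def, P.v_algebraMap_le_one c]
  · obtain ⟨c, hc⟩ := exists_algebraMap_eq_of_regular hF hQ (z := z)
      (fun P => by simpa using z.2 P)
    exact ⟨c, Subtype.ext (by rw [hc, Algebra.algebraMap_eq_smul_one]; rfl)⟩

/-- Leading coefficients at a rational place are scalars, so allowing one more pole there adds at
most one dimension. -/
lemma finiteDimensional_riemannRochSpace_add_single (D : Divisor k F) {Q : Place k F}
    (hQ : Q.IsRational) (h : FiniteDimensional k (riemannRochSpace D)) :
    FiniteDimensional k (riemannRochSpace (D + Finsupp.single Q 1)) := by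
  classical
  by_cases hex : ∃ f ∈ riemannRochSpace (D + Finsupp.single Q 1), Q.v f = WithZero.exp (D Q + 1)
  · obtain ⟨f, hf, hfQ⟩ := hex
    have hf0 : f ≠ 0 := by
      rintro rfl
      exact WithZero.exp_ne_zero (by rw [← hfQ, map_zero])
    have hle : riemannRochSpace (D + Finsupp.single Q 1) ≤ riemannRochSpace D ⊔ k ∙ f := by
      intro g hg
      have hgQ : Q.v g ≤ WithZero.exp (D Q + 1) := by simpa using hg Q
      obtain ⟨c, hc⟩ := hQ (g / f) (by
        rw [map_div₀, hfQ]
        exact div_le_one_of_le₀ hgQ zero_le)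
      refine Submodule.mem_sup.2 ⟨g - c • f, fun P => ?_, c • f,
        Submodule.smul_mem _ _ (Submodule.mem_span_singleton_self f), by ring⟩
      by_cases hP : P = Q
      · subst hP
        have h1 : g - c • f = (g / f - algebraMap k F c) * f := by
          rw [Algebra.smul_def]
          field_simp
        rw [h1, map_mul, hfQ, ← WithZero.lt_mul_exp_iff_le WithZero.exp_ne_zero,
          ← WithZero.exp_add]
        exact mul_lt_of_lt_one_left (zero_lt_iff.2 WithZero.exp_ne_zero) hc
      · have hmem : g - c • f ∈ riemannRochSpace (D + Finsupp.single Q 1) :=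
          Submodule.sub_mem _ hg (Submodule.smul_mem _ c hf)
        have h1 := hmem P
        simpa [Finsupp.single_apply, Ne.symm hP] using h1
    exact Submodule.finiteDimensional_of_le hle
  · push Not at hex
    refine Submodule.finiteDimensional_of_le (S₂ := riemannRochSpace D) fun f hf P => ?_
    have h1 := hf P
    by_cases hP : P = Q
    · subst hP
      rw [← WithZero.lt_mul_exp_iff_le WithZero.exp_ne_zero, ← WithZero.exp_add]
      exact lt_of_le_of_ne (by simpa using h1) (hex f hf)
    · simpa [Finsupp.single_apply, Ne.symm hP] using h1

lemma finiteDimensional_riemannRochSpace_tupleDivisor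
    (hF : ∀ s : F, Transcendental k s → FiniteDimensional k⟮s⟯ F)
    {n : ℕ} (i₀ : Fin n) (Q : Fin n → Place k F)
    (hQ : ∀ i, (Q i).IsRational) (α : Fin n → ℤ) (hα : ∀ i, 0 ≤ α i) :
    FiniteDimensional k (riemannRochSpace (tupleDivisor Q α)) := by
  classical
  suffices h : ∀ S : Finset (Fin n),
      FiniteDimensional k (riemannRochSpace (∑ i ∈ S, Finsupp.single (Q i) (α i))) from h _
  intro S
  induction S using Finset.induction_on with
  | empty =>
    rw [Finset.sum_empty]
    exact finiteDimensional_riemannRochSpace_zero hF (hQ i₀)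
  | insert i S hi ih =>
    obtain ⟨m, hm⟩ := Int.eq_ofNat_of_zero_le (hα i)
    rw [Finset.sum_insert hi, hm, add_comm]
    clear hm
    induction m with
    | zero =>
      rw [Nat.cast_zero, Finsupp.single_zero, add_zero]
      exact ih
    | succ m ihm =>
      rw [Nat.cast_succ, Finsupp.single_add, ← add_assoc]
      exact finiteDimensional_riemannRochSpace_add_single _ (hQ i) ihm

end Existence

/-! ### Gaps at a place and relative maximal elements -/

section Semigroup

variable {n : ℕ} {Q : Fin n → Place k F}

lemma Place.v_eq_exp_neg_ord (P : Place k F) {f : F} (hf : f ≠ 0) :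
    P.v f = WithZero.exp (-P.ord f) := by
  rw [Place.ord, neg_neg, WithZero.exp_log ((Valuation.ne_zero_iff _).2 hf)]

lemma Place.ne_zero_of_v_eq_exp {P : Place k F} {f : F} {a : ℤ} (h : P.v f = WithZero.exp a) :
    f ≠ 0 := by
  rintro rfl
  exact WithZero.exp_ne_zero (by rw [← h, map_zero])

lemma Place.v_eq_exp_iff (P : Place k F) {f : F} (hf : f ≠ 0) (a : ℤ) :
    P.v f = WithZero.exp a ↔ a = -P.ord f := by
  rw [P.v_eq_exp_neg_ord hf, WithZero.exp_inj, eq_comm]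

lemma WithZero.lt_exp_add_one_iff {x : ℤᵐ⁰} {a : ℤ} :
    x < WithZero.exp (a + 1) ↔ x ≤ WithZero.exp a := by
  rw [WithZero.exp_add, WithZero.lt_mul_exp_iff_le WithZero.exp_ne_zero]

lemma tupleDivisor_apply (hQ : Function.Injective Q) (α : Fin n → ℤ) (i : Fin n) :
    tupleDivisor Q α (Q i) = α i := by
  classical
  rw [tupleDivisor, Finsupp.finsetSum_apply, Finset.sum_eq_single i]
  · simp
  · intro j _ hj
    exact Finsupp.single_eq_of_ne (fun h => hj (hQ h).symm)
  · simp

lemma tupleDivisor_apply_of_notMem (α : Fin n → ℤ) {P : Place k F} (hP : P ∉ Set.range Q) :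
    tupleDivisor Q α P = 0 := by
  rw [tupleDivisor, Finsupp.finsetSum_apply]
  exact Finset.sum_eq_zero fun j _ => Finsupp.single_eq_of_ne fun h => hP ⟨j, h.symm⟩

lemma mem_riemannRochSpace_tupleDivisor (hQ : Function.Injective Q) (α : Fin n → ℤ) (f : F) :
    f ∈ riemannRochSpace (tupleDivisor Q α) ↔
      f ∈ regularOutside Q ∧ ∀ i, (Q i).v f ≤ WithZero.exp (α i) := by
  constructor
  · refine fun h => ⟨fun P hP => ?_, fun i => ?_⟩
    · simpa [tupleDivisor_apply_of_notMem α hP] using h P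
    · simpa [tupleDivisor_apply hQ] using h (Q i)
  · rintro ⟨h1, h2⟩ P
    by_cases hP : P ∈ Set.range Q
    · obtain ⟨i, rfl⟩ := hP
      rw [tupleDivisor_apply hQ]
      exact h2 i
    · rw [tupleDivisor_apply_of_notMem α hP, WithZero.exp_zero]
      exact h1 P hP

lemma sum_smul_mem_regularOutside {ι : Type*} (J : Finset ι) (c : ι → k) {f : ι → F}
    (hf : ∀ i ∈ J, f i ∈ regularOutside Q) : ∑ i ∈ J, c i • f i ∈ regularOutside Q :=
  fun P hP => Valuation.map_sum_le _ fun i hi => (P.v_smul_le _ _).trans (hf i hi P hP)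

lemma mem_genWeierstrassSemigroup_iff [NeZero n] (α : Fin n → ℤ) :
    α ∈ genWeierstrassSemigroup Q ↔
      ∃ f ∈ regularOutside Q, ∀ i, (Q i).v f = WithZero.exp (α i) := by
  constructor
  · rintro ⟨f, hf, hf0, h⟩
    exact ⟨f, hf, fun i => ((Q i).v_eq_exp_iff hf0 _).2 (h i)⟩
  · rintro ⟨f, hf, h⟩
    have hf0 := Place.ne_zero_of_v_eq_exp (h 0)
    exact ⟨f, hf, hf0, fun i => ((Q i).v_eq_exp_iff hf0 _).1 (h i)⟩

/-- Nonemptiness of `J` is what forces `f ≠ 0`. -/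
lemma nabla_nonempty_iff {J : Finset (Fin n)} (hJ : J.Nonempty) (α : Fin n → ℤ) :
    (nabla Q J α).Nonempty ↔ ∃ f ∈ regularOutside Q,
      (∀ j ∈ J, (Q j).v f = WithZero.exp (α j)) ∧ ∀ i ∉ J, (Q i).v f < WithZero.exp (α i) := by
  constructor
  · rintro ⟨β, ⟨h1, h2⟩, f, hf, hf0, h⟩
    refine ⟨f, hf, fun j hj => ?_, fun i hi => ?_⟩
    · rw [(Q j).v_eq_exp_iff hf0, ← h1 j hj, h j]
    · rw [(Q i).v_eq_exp_neg_ord hf0, ← h i, WithZero.exp_lt_exp]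
      exact h2 i hi
  · rintro ⟨f, hf, h1, h2⟩
    obtain ⟨j, hj⟩ := hJ
    have hf0 := Place.ne_zero_of_v_eq_exp (h1 j hj)
    refine ⟨fun i => -(Q i).ord f, ⟨fun j hj => ?_, fun i hi => ?_⟩, f, hf, hf0, fun i => rfl⟩
    · exact (((Q j).v_eq_exp_iff hf0 _).1 (h1 j hj)).symm
    · have := h2 i hi
      rwa [(Q i).v_eq_exp_neg_ord hf0, WithZero.exp_lt_exp] at this

/-- No function regular outside `Q` with pole divisor part bounded by `β` has valuation exactly
`-β_l` at `Q_l`. -/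
def IsGapAt (Q : Fin n → Place k F) (l : Fin n) (β : Fin n → ℤ) : Prop :=
  ∀ f ∈ regularOutside Q, (Q l).v f = WithZero.exp (β l) →
    ¬ ∀ i, (Q i).v f ≤ WithZero.exp (β i)

lemma riemannRochSpace_sub_single_le (D : Divisor k F) (P : Place k F) :
    riemannRochSpace (D - Finsupp.single P 1) ≤ riemannRochSpace D := by
  classical
  intro f hf R
  refine (hf R).trans ?_
  rw [WithZero.exp_le_exp, Finsupp.sub_apply, sub_le_self_iff, Finsupp.single_apply]
  split_ifs <;> norm_num

lemma riemannRochSpace_sub_single_eq_iff (hQ : Function.Injective Q) (l : Fin n) (α : Fin n → ℤ) :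
    riemannRochSpace (tupleDivisor Q α - Finsupp.single (Q l) 1) =
      riemannRochSpace (tupleDivisor Q α) ↔ IsGapAt Q l α := by
  classical
  constructor
  · intro h f hf hfl hfi
    have h1 := h.ge ((mem_riemannRochSpace_tupleDivisor hQ α f).2 ⟨hf, hfi⟩) (Q l)
    rw [hfl, WithZero.exp_le_exp] at h1
    simp [tupleDivisor_apply hQ] at h1
  · intro h
    refine le_antisymm (riemannRochSpace_sub_single_le _ _) fun f hf P => ?_
    have h1 := hf P
    by_cases hP : P = Q l
    · subst hP
      obtain ⟨hreg, hi⟩ := (mem_riemannRochSpace_tupleDivisor hQ α f).1 hf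
      rw [← WithZero.lt_exp_add_one_iff, Finsupp.sub_apply, tupleDivisor_apply hQ,
        Finsupp.single_eq_same, sub_add_cancel]
      exact lt_of_le_of_ne (hi l) fun h2 => h f hreg h2 hi
    · simpa [Finsupp.single_apply, Ne.symm hP] using h1

/-- The pure gaps are the `α ≥ 0` which are gaps at every place of the tuple. -/
lemma mem_pureGaps_iff [NeZero n]
    (hF : ∀ s : F, Transcendental k s → FiniteDimensional k⟮s⟯ F)
    (hQ : Function.Injective Q) (hrat : ∀ i, (Q i).IsRational) (α : Fin n → ℤ) :
    α ∈ pureGaps Q ↔ (∀ i, 0 ≤ α i) ∧ ∀ l, IsGapAt Q l α := by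
  classical
  constructor
  · rintro ⟨⟨h0, -⟩, h⟩
    refine ⟨h0, fun l => ?_⟩
    rw [← riemannRochSpace_sub_single_eq_iff hQ]
    -- Equal `finrank` gives equal spaces only in finite dimension.
    have := finiteDimensional_riemannRochSpace_tupleDivisor hF 0 Q hrat α h0
    exact Submodule.eq_of_le_of_finrank_eq (riemannRochSpace_sub_single_le _ _) (h l).symm
  · rintro ⟨h0, h⟩
    refine ⟨⟨h0, ?_⟩, fun l => ?_⟩
    · rintro ⟨-, f, hf0, hf⟩
      have hle : ∀ P : Place k F, P.v f ≤ WithZero.exp (tupleDivisor Q α P) := fun P => by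
        rw [hf P, P.v_eq_exp_neg_ord hf0, WithZero.exp_le_exp]
        exact le_max_left _ _
      -- A function with pole divisor `D_α` attains every positive `α i`, contradicting the gap at
      -- `i`. For `α = 0` the constant 1 does so.
      by_cases hα : ∃ i, 0 < α i
      · obtain ⟨i, hi⟩ := hα
        obtain ⟨hreg, hfi⟩ := (mem_riemannRochSpace_tupleDivisor hQ α f).1 hle
        refine h i f hreg ?_ hfi
        have h1 := hf (Q i)
        rw [tupleDivisor_apply hQ] at h1
        rw [(Q i).v_eq_exp_iff hf0]
        omega
      · push Not at hα
        have hα0 : ∀ i, α i = 0 := fun i => le_antisymm (hα i) (h0 i)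
        exact h 0 1 (fun P _ => by simp) (by simp [hα0]) (by simp [hα0])
    · rw [ell, ell, (riemannRochSpace_sub_single_eq_iff hQ l α).2 (h l)]

lemma isGapAt_of_nabla_eq_empty {l : Fin n} {α β : Fin n → ℤ} (h : nabla Q {l} β = ∅)
    (hl : α l = β l) (hlt : ∀ i, i ≠ l → α i < β i) : IsGapAt Q l α := by
  intro f hf hfl hfi
  rw [← Set.not_nonempty_iff_eq_empty, nabla_nonempty_iff (Finset.singleton_nonempty l)] at h
  refine h ⟨f, hf, fun j hj => ?_, fun i hi => (hfi i).trans_lt ?_⟩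
  · rw [Finset.mem_singleton.1 hj, ← hl, hfl]
  · rw [WithZero.exp_lt_exp]
    exact hlt i fun h => hi (Finset.mem_singleton.2 h)

/-- All coefficients 1 work unless `|J| = 0` in `k`; then replacing one of them by `t` gives the sum
`t - 1`. -/
lemma exists_ne_zero_sum_ne_zero {ι : Type*} (J : Finset ι) (hJ : J.Nonempty)
    (hk : 2 ≤ J.card → ∃ t : k, t ≠ 0 ∧ t ≠ 1) :
    ∃ c : ι → k, (∀ i ∈ J, c i ≠ 0) ∧ ∑ i ∈ J, c i ≠ 0 := by
  classical
  by_cases h : (J.card : k) = 0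
  · obtain ⟨i, hi⟩ := hJ
    have h2 : 2 ≤ J.card := by
      by_contra h2
      have : J.card = 1 := by have := Finset.card_pos.2 ⟨i, hi⟩; omega
      simp [this] at h
    obtain ⟨t, ht0, ht1⟩ := hk h2
    refine ⟨Function.update 1 i t, fun j _ => ?_, ?_⟩
    · by_cases hj : j = i
      · subst hj
        simpa
      · simp [hj]
    · rw [Finset.sum_update_of_mem hi]
      have : ∑ x ∈ J \ {i}, (1 : ι → k) x = -1 := by
        have h3 := Finset.sum_sdiff_eq_sub (f := fun _ : ι => (1 : k)) (Finset.singleton_subset_iff.2 hi)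
        simpa [h] using h3
      rw [this, ← sub_eq_add_neg]
      exact sub_ne_zero.2 ht1
  · exact ⟨1, by simp, by simpa using h⟩

lemma exists_ne_zero_sum_eq_zero {ι : Type*} (J : Finset ι) (hJ : 2 ≤ J.card)
    (hk : ∃ t : k, t ≠ 0 ∧ t ≠ 1) :
    ∃ c : ι → k, (∀ i ∈ J, c i ≠ 0) ∧ ∑ i ∈ J, c i = 0 := by
  classical
  obtain ⟨i, hi⟩ := Finset.card_pos.1 (by omega : 0 < J.card)
  obtain ⟨c, hc, hsum⟩ := exists_ne_zero_sum_ne_zero (J.erase i)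
    (Finset.card_pos.1 (by rw [Finset.card_erase_of_mem hi]; omega)) fun _ => hk
  refine ⟨Function.update c i (-∑ j ∈ J.erase i, c j), fun j hj => ?_, ?_⟩
  · by_cases h : j = i
    · subst h
      simpa using hsum
    · simpa [h] using hc j (Finset.mem_erase.2 ⟨h, hj⟩)
  · rw [Finset.sum_update_of_mem hi, Finset.sdiff_singleton_eq_erase, neg_add_cancel]

lemma Place.IsRational.exists_v_sub_smul_lt {P : Place k F} (hP : P.IsRational) {f h : F} {a : ℤ}
    (hf : P.v f = WithZero.exp a) (hh : P.v h = WithZero.exp a) :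
    ∃ c : k, c ≠ 0 ∧ P.v (f - c • h) < WithZero.exp a := by
  have hh0 := Place.ne_zero_of_v_eq_exp hh
  obtain ⟨c, hc⟩ := hP (f / h) (by rw [map_div₀, hf, hh, div_self WithZero.exp_ne_zero])
  refine ⟨c, ?_, ?_⟩
  · rintro rfl
    rw [map_zero, sub_zero, map_div₀, hf, hh, div_self WithZero.exp_ne_zero] at hc
    exact lt_irrefl _ hc
  · have h1 : f - c • h = (f / h - algebraMap k F c) * h := by
      rw [Algebra.smul_def]
      field_simp
    rw [h1, map_mul, hh]
    exact mul_lt_of_lt_one_left (zero_lt_iff.2 WithZero.exp_ne_zero) hc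

/-- Above a nonnegative gap at `l` there is a maximal one with the same `l`-th coordinate. -/
lemma exists_maximal_isGapAt (hF : ∀ s : F, Transcendental k s → FiniteDimensional k⟮s⟯ F)
    (hQ : Function.Injective Q) {l : Fin n} {α : Fin n → ℤ} (h0 : ∀ i, 0 ≤ α i)
    (hα : IsGapAt Q l α) :
    ∃ β, Maximal (fun β : Fin n → ℤ => α ≤ β ∧ β l = α l ∧ IsGapAt Q l β) β := by
  have hex : ∀ i, ∃ N : ℤ, ∀ β : Fin n → ℤ, α ≤ β → β l = α l → IsGapAt Q l β → β i ≤ N := by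
    intro i
    by_cases hi : i = l
    · subst hi
      exact ⟨α i, fun β _ h _ => h.le⟩
    -- Once `β i` exceeds the pole order of `f` at `Q i`, this `f` itself violates the gap
    -- condition.
    · obtain ⟨f, hf, hreg⟩ := exists_v_eq_exp_regular hF (hQ.ne (Ne.symm hi)) (α l) (h0 l)
      refine ⟨-(Q i).ord f, fun β hβ hl hgap => ?_⟩
      by_contra! hlt
      refine hgap f (fun P hP => hreg P (fun h => hP ⟨l, h.symm⟩) fun h => hP ⟨i, h.symm⟩)
        (by rw [hf, hl]) fun j => ?_
      by_cases hjl : j = l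
      · rw [hjl, hf, hl]
      · by_cases hji : j = i
        · rw [hji, (Q i).v_eq_exp_neg_ord (Place.ne_zero_of_v_eq_exp hf), WithZero.exp_le_exp]
          exact hlt.le
        · refine (hreg (Q j) (hQ.ne hjl) (hQ.ne hji)).trans ?_
          rw [← WithZero.exp_zero, WithZero.exp_le_exp]
          exact (h0 j).trans (hβ j)
  choose N hN using hex
  have hfin : {β : Fin n → ℤ | α ≤ β ∧ β l = α l ∧ IsGapAt Q l β}.Finite :=
    (Set.finite_Icc α N).subset fun β ⟨h1, h2, h3⟩ => ⟨h1, fun i => hN i β h1 h2 h3⟩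
  exact hfin.exists_maximal ⟨α, le_rfl, rfl, hα⟩

/-- Key construction: every nonnegative gap at `l` lies below a relative maximal element with the
same `l`-th coordinate, strictly in all other coordinates. -/
lemma exists_mem_relMax (hF : ∀ s : F, Transcendental k s → FiniteDimensional k⟮s⟯ F)
    (hn : 2 ≤ n) (hk : 3 ≤ n → ∃ t : k, t ≠ 0 ∧ t ≠ 1) (hQ : Function.Injective Q)
    (hrat : ∀ i, (Q i).IsRational) {l : Fin n} {α : Fin n → ℤ} (h0 : ∀ i, 0 ≤ α i)
    (hα : IsGapAt Q l α) :
    ∃ β ∈ relMax Q, β l = α l ∧ ∀ i, i ≠ l → α i < β i := by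
  classical
  have : NeZero n := ⟨by omega⟩
  obtain ⟨γ, ⟨hαγ, hγl, hγ⟩, hmax⟩ := exists_maximal_isGapAt hF hQ h0 hα
  -- Off `l`, the shift by 1 turns the bounds `≤ γ i` into `< β i`.
  set β : Fin n → ℤ := fun j => if j = l then γ l else γ j + 1 with hβ
  have hβl : β l = γ l := by simp [hβ]
  have hβi : ∀ i, i ≠ l → β i = γ i + 1 := fun i hi => by simp [hβ, hi]
  have hgap : ∀ f ∈ regularOutside Q, (Q l).v f = WithZero.exp (β l) →
      ¬ ∀ i, i ≠ l → (Q i).v f < WithZero.exp (β i) := by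
    intro f hf hfl h
    refine hγ f hf (by rw [hfl, hβl]) fun i => ?_
    by_cases hi : i = l
    · rw [hi, hfl, hβl]
    · rw [← WithZero.lt_exp_add_one_iff, ← hβi i hi]
      exact h i hi
  have hstep : ∀ i, i ≠ l → ∃ f ∈ regularOutside Q, (Q l).v f = WithZero.exp (β l) ∧
      (Q i).v f = WithZero.exp (β i) ∧ ∀ j, j ≠ l → j ≠ i → (Q j).v f < WithZero.exp (β j) := by
    intro i hi
    have hnot : ¬ IsGapAt Q l (Function.update γ i (γ i + 1)) := by
      intro h
      have hle : γ ≤ Function.update γ i (γ i + 1) := by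
        rw [le_update_iff]
        exact ⟨by omega, fun _ _ => le_rfl⟩
      have h1 := hmax ⟨hαγ.trans hle, by simp [Ne.symm hi, hγl], h⟩ hle i
      simp at h1
    rw [IsGapAt] at hnot
    push Not at hnot
    obtain ⟨f, hf, hfl, hfi⟩ := hnot
    rw [Function.update_of_ne (Ne.symm hi)] at hfl
    have hlt : ∀ j, j ≠ l → j ≠ i → (Q j).v f < WithZero.exp (β j) := fun j hj hji => by
      rw [hβi j hj, WithZero.lt_exp_add_one_iff]
      simpa [hji] using hfi j
    refine ⟨f, hf, by rw [hfl, hβl], ?_, hlt⟩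
    -- Order strictly below `β i` at `Q i` would contradict the gap `γ`.
    by_contra hne
    refine hgap f hf (by rw [hfl, hβl]) fun j hj => ?_
    by_cases hji : j = i
    · subst hji
      exact lt_of_le_of_ne (by simpa [hβi j hj] using hfi j) hne
    · exact hlt j hj hji
  -- `h` is a reference for leading coefficients at `Q l`: with every `f i` matching it, `∑ c j • f
  -- j` has leading coefficient `∑ c j` relative to `h`.
  obtain ⟨h, hh⟩ := (Q l).exists_v_eq_exp (β l)
  have hnorm : ∀ i, ∃ f : F, i ≠ l → f ∈ regularOutside Q ∧
      (Q l).v (f - h) < WithZero.exp (β l) ∧ (Q i).v f = WithZero.exp (β i) ∧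
      ∀ j, j ≠ l → j ≠ i → (Q j).v f < WithZero.exp (β j) := by
    intro i
    by_cases hi : i = l
    · exact ⟨0, fun h => absurd hi h⟩
    obtain ⟨f, hf, hfl, hfi, hfj⟩ := hstep i hi
    obtain ⟨c, hc, hlt⟩ := (hrat l).exists_v_sub_smul_lt hfl hh
    have hc' := inv_ne_zero hc
    refine ⟨c⁻¹ • f, fun _ => ⟨fun P hP => ?_, ?_, ?_, fun j h1 h2 => ?_⟩⟩
    · rw [Place.v_smul _ hc']
      exact hf P hP
    · have h1 : c⁻¹ • f - h = c⁻¹ • (f - c • h) := by rw [smul_sub, inv_smul_smul₀ hc]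
      rwa [h1, Place.v_smul _ hc']
    · rw [Place.v_smul _ hc', hfi]
    · rw [Place.v_smul _ hc']
      exact hfj j h1 h2
  choose f hf using hnorm
  -- the values of the linear combinations of the `f i`
  have hsum_in : ∀ (J : Finset (Fin n)) (c : Fin n → k), l ∉ J → (∀ i ∈ J, c i ≠ 0) →
      ∀ i ∈ J, (Q i).v (∑ j ∈ J, c j • f j) = WithZero.exp (β i) := by
    intro J c hl hc i hi
    have hil : i ≠ l := fun h => hl (h ▸ hi)
    have h1 : (Q i).v (c i • f i) = WithZero.exp (β i) := by
      rw [Place.v_smul _ (hc i hi), (hf i hil).2.2.1]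
    rw [← Finset.add_sum_erase _ _ hi, Valuation.map_add_eq_of_lt_left, h1]
    rw [h1]
    refine Valuation.map_sum_lt _ WithZero.exp_ne_zero fun j hj => ?_
    have hjl : j ≠ l := fun h => hl (h ▸ Finset.mem_of_mem_erase hj)
    exact ((Q i).v_smul_le _ _).trans_lt
      ((hf j hjl).2.2.2 i hil (Finset.ne_of_mem_erase hj).symm)
  have hsum_out : ∀ (J : Finset (Fin n)) (c : Fin n → k), l ∉ J →
      ∀ i ∉ J, i ≠ l → (Q i).v (∑ j ∈ J, c j • f j) < WithZero.exp (β i) := by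
    intro J c hl i hi hil
    refine Valuation.map_sum_lt _ WithZero.exp_ne_zero fun j hj => ?_
    have hjl : j ≠ l := fun h => hl (h ▸ hj)
    exact ((Q i).v_smul_le _ _).trans_lt ((hf j hjl).2.2.2 i hil fun h => hi (h ▸ hj))
  have hsum_l : ∀ (J : Finset (Fin n)) (c : Fin n → k), l ∉ J →
      (Q l).v (∑ j ∈ J, c j • f j - (∑ j ∈ J, c j) • h) < WithZero.exp (β l) := by
    intro J c hl
    rw [Finset.sum_smul, ← Finset.sum_sub_distrib]
    refine Valuation.map_sum_lt _ WithZero.exp_ne_zero fun j hj => ?_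
    rw [← smul_sub]
    exact ((Q l).v_smul_le _ _).trans_lt (hf j fun h => hl (h ▸ hj)).2.1
  have hsum_reg : ∀ (J : Finset (Fin n)) (c : Fin n → k), l ∉ J →
      ∑ j ∈ J, c j • f j ∈ regularOutside Q := fun J c hl =>
    sum_smul_mem_regularOutside J c fun j hj => (hf j fun h => hl (h ▸ hj)).1
  have hcomb : ∀ J : Finset (Fin n), l ∉ J → J.Nonempty → ∃ g ∈ regularOutside Q,
      (∀ i ∈ insert l J, (Q i).v g = WithZero.exp (β i)) ∧
        ∀ i ∉ insert l J, (Q i).v g < WithZero.exp (β i) := by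
    intro J hl hJ
    -- Since `l ∉ J`, two elements in `J` force `n ≥ 3`.
    obtain ⟨c, hc, hc0⟩ := exists_ne_zero_sum_ne_zero (k := k) J hJ fun h2 => hk (by
      have := Finset.card_le_univ (insert l J)
      rw [Finset.card_insert_of_notMem hl, Fintype.card_fin] at this
      omega)
    refine ⟨_, hsum_reg J c hl, fun i hi => ?_, fun i hi => ?_⟩
    · rcases Finset.mem_insert.1 hi with rfl | hi
      · have h1 : (Q i).v ((∑ j ∈ J, c j) • h) = WithZero.exp (β i) := by
          rw [Place.v_smul _ hc0, hh]
        rw [← sub_add_cancel (∑ j ∈ J, c j • f j) ((∑ j ∈ J, c j) • h),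
          Valuation.map_add_eq_of_lt_right, h1]
        rw [h1]
        exact hsum_l J c hl
      · exact hsum_in J c hl hc i hi
    · rw [Finset.mem_insert, not_or] at hi
      exact hsum_out J c hl i hi.2 hi.1
  refine ⟨β, ⟨⟨⟨?_, ?_⟩, fun J hJ hJ2 => ?_⟩, fun i => ?_⟩, by rw [hβl, hγl], fun i hi => ?_⟩
  · rw [mem_genWeierstrassSemigroup_iff]
    obtain ⟨g, hg, hgi, -⟩ := hcomb (Finset.univ.erase l) (Finset.notMem_erase _ _)
      (Finset.card_pos.1 (by
        rw [Finset.card_erase_of_mem (Finset.mem_univ l), Finset.card_univ, Fintype.card_fin]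
        omega))
    exact ⟨g, hg, fun i => hgi i (by by_cases hi : i = l <;> simp [hi])⟩
  · rw [Set.iUnion_eq_empty]
    intro i
    rw [← Set.not_nonempty_iff_eq_empty, nabla_nonempty_iff (Finset.singleton_nonempty i)]
    rintro ⟨g, hg, hgi, hgj⟩
    have hgi' := hgi i (Finset.mem_singleton_self i)
    have hgj' : ∀ j, j ≠ i → (Q j).v g < WithZero.exp (β j) := fun j hj =>
      hgj j fun h => hj (Finset.mem_singleton.1 h)
    by_cases hi : i = l
    · subst hi
      exact hgap g hg hgi' hgj'
    -- Cancelling the leading term of `f'` at `Q i` by a multiple of `g` keeps the order `β l` at `Q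
    -- l`, since `g` is smaller there. The result contradicts `hgap`.
    · obtain ⟨f', hf', hfl, hfi, hfj⟩ := hstep i hi
      obtain ⟨c, -, hlt⟩ := (hrat i).exists_v_sub_smul_lt hfi hgi'
      have hcg : ∀ j, j ≠ i → (Q j).v (c • g) < WithZero.exp (β j) := fun j hj =>
        ((Q j).v_smul_le _ _).trans_lt (hgj' j hj)
      refine hgap (f' - c • g) (fun P hP => ?_) ?_ fun j hj => ?_
      · exact (Valuation.map_sub _ _ _).trans
          (max_le (hf' P hP) ((P.v_smul_le _ _).trans (hg P hP)))
      · rw [Valuation.map_sub_eq_of_lt_left, hfl]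
        rw [hfl]
        exact hcg l (Ne.symm hi)
      · by_cases hji : j = i
        · rwa [hji]
        · exact (Valuation.map_sub _ _ _).trans_lt (max_lt (hfj j hj hji) (hcg j hji))
  · rw [nabla_nonempty_iff (Finset.card_pos.1 (by omega))]
    by_cases hl : l ∈ J
    · rw [← Finset.insert_erase hl]
      exact hcomb (J.erase l) (Finset.notMem_erase _ _)
        (Finset.card_pos.1 (by rw [Finset.card_erase_of_mem hl]; omega))
    -- For `l ∉ J` the leading terms at `Q l` must cancel, hence coefficients of sum zero.
    · obtain ⟨c, hc, hc0⟩ := exists_ne_zero_sum_eq_zero (k := k) J hJ2 (hk (by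
        have := Finset.card_lt_card hJ
        rw [Finset.card_univ, Fintype.card_fin] at this
        omega))
      refine ⟨_, hsum_reg J c hl, hsum_in J c hl hc, fun i hi => ?_⟩
      by_cases hil : i = l
      · have := hsum_l J c hl
        rw [hc0, zero_smul, sub_zero] at this
        rwa [hil]
      · exact hsum_out J c hl i hi hil
  · have h1 := (h0 i).trans (hαγ i)
    by_cases hi : i = l
    · rw [hi, hβl]
      rwa [hi] at h1
    · rw [hβi i hi]
      omega
  · rw [hβi i hi]
    exact Int.lt_add_one_of_le (hαγ i)

end Semigroup

end FnField

/-! ### The main theorem -/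

theorem mainTheorem8 {k F : Type*} [Field k] [Field F] [Algebra k F]
    [Algebra (RatFunc k) F] [IsScalarTower k (RatFunc k) F] [FunctionField k F]
    (n : ℕ) (hn : 2 ≤ n) (hk : (n : Cardinal) ≤ Cardinal.mk k)
    (Q : Fin n → FnField.Place k F) (hQ : Function.Injective Q)
    (hrat : ∀ i, (Q i).IsRational) :
    FnField.pureGaps Q =
      {α | ∃ β : Fin n → Fin n → ℤ,
        (∀ l, β l ∈ FnField.relMax Q) ∧
        (∀ l j, j ≠ l → β l l < β j l) ∧
        α = FnField.glb β} := by
  classical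
  have : NeZero n := ⟨by omega⟩
  have hF : ∀ s : F, Transcendental k s → FiniteDimensional k⟮s⟯ F :=
    FnField.finiteDimensional_adjoin_of_transcendental
  -- The size of `k` enters only here: with `n ≥ 3` there must be an element besides 0 and 1.
  have hk3 : 3 ≤ n → ∃ t : k, t ≠ 0 ∧ t ≠ 1 := by
    intro h3
    by_contra! hc
    have hle : Cardinal.mk (Set.univ : Set k) ≤ 2 := by
      have hsub : (Set.univ : Set k) ⊆ (({0, 1} : Finset k) : Set k) := by
        intro t _
        by_cases ht : t = 0
        · simp [ht]
        · simp [hc t ht]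
      refine (Cardinal.mk_le_mk_of_subset hsub).trans ?_
      rw [SetLike.coe_sort_coe, Cardinal.mk_coe_finset]
      exact_mod_cast Finset.card_le_two
    rw [Cardinal.mk_univ] at hle
    have : n ≤ 2 := by exact_mod_cast hk.trans hle
    omega
  ext α
  rw [FnField.mem_pureGaps_iff hF hQ hrat, Set.mem_ofPred_eq]
  constructor
  · rintro ⟨h0, hgap⟩
    choose β hβ hβl hβi using fun l => FnField.exists_mem_relMax hF hn hk3 hQ hrat h0 (hgap l)
    refine ⟨β, hβ, fun l j hj => ?_, ?_⟩
    · rw [hβl]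
      exact hβi j l (Ne.symm hj)
    · funext l
      have hleast : IsLeast (Set.range fun j => β j l) (α l) := by
        refine ⟨⟨l, hβl l⟩, ?_⟩
        rintro _ ⟨j, rfl⟩
        by_cases hj : j = l
        · subst hj
          exact (hβl j).ge
        · exact (hβi j l (Ne.symm hj)).le
      exact hleast.unique (FnField.glb_isLeast (by omega) β l)
  · rintro ⟨β, hβ, hlt, rfl⟩
    -- The strict inequalities place the minimum of the `l`-th coordinates at `β l`.
    have hglb : ∀ l, FnField.glb β l = β l l := fun l => by
      have hleast : IsLeast (Set.range fun j => β j l) (β l l) := by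
        refine ⟨⟨l, rfl⟩, ?_⟩
        rintro _ ⟨j, rfl⟩
        by_cases hj : j = l
        · rw [hj]
        · exact (hlt l j hj).le
      exact (FnField.glb_isLeast (by omega) β l).unique hleast
    refine ⟨fun l => ?_, fun l => ?_⟩
    · rw [hglb]
      exact (hβ l).2 l
    · refine FnField.isGapAt_of_nabla_eq_empty (Set.iUnion_eq_empty.1 (hβ l).1.1.2 l) (hglb l)
        fun i hi => ?_
      rw [hglb]
      exact hlt i l (Ne.symm hi)
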